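/- Throughout, $\mathbb R^n,\mathbb R^m$ carry the Euclidean inner product, and all set limits are in the Painlevé–Kuratowski sense. **Notation.** For a set $C$ and $x\in C$, $T_C(x)=\limsup_{t\downarrow 0}(C-x)/t$ is the tangent cone and, for $C$ convex, $N_C(x)=\{v:\langle v,w\rangle\le 0\ \ \forall w\in T_C(x)\}$ is the normal cone. For a convex cone $K$, $\mathrm{lin}(K)=K\cap(-K)$; $\mathrm{aff}$ denotes the affine hull; $\iota_C$ is the indicator function of $C$ ($0$ on $C$, $+\infty$ elsewhere); $\sigma_Q(y)=\sup_{q\in Q}\langle q,y\rangle$ is the support function of $Q$; and $\mathrm{dom}(\theta)=\{x:\theta(x)<\infty\}$. For $\theta:\mathbb R^n\to(-\infty,\infty]$ and $x\in\mathrm{dom}(\theta)$, the regular subdifferential is $\hat\partial\theta(x)=\{v:\theta(y)\ge\theta(x)+\langle v,y-x\rangle+o(\|y-x\|)\text{ as }y\to x\}$ and the subdifferential is $\partial\theta(x)=\limsup_{y\to x,\ \theta(y)\to\theta(x)}\hat\partial\theta(y)$; both are empty if $x\notin\mathrm{dom}(\theta)$. The strict second subderivative of $\theta$ at $\bar x\in\mathrm{dom}(\theta)$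 for $\bar v$ is $$\mathrm d^2_s\theta(\bar x|\bar v)(h)=\liminf_{\substack{t\downarrow 0,\ \tilde h\to h,\ \theta(x)\to\theta(\bar x)\\ \mathrm{gph}(\partial\theta)\ni(x,v)\to(\bar x,\bar v)}}\frac{\theta(x+t\tilde h)-\theta(x)-t\langle v,\tilde h\rangle}{\tfrac12t^2}.$$ **Strict $u$-decomposability.** Let $\varphi:\mathbb R^n\to(-\infty,\infty]$, $\bar x\in\mathrm{dom}(\varphi)$, let $Q\subseteq\mathbb R^m$ be nonempty, closed and convex, and let $\bar\lambda\in Q$. We say that $\varphi$ is $C^2$-strictly $u$-decomposable at $\bar x$ for $\bar\lambda$ with decomposition pair $(\sigma_Q,F)$ if there is an open neighborhood $U$ of $\bar x$ such that $F:U\to\mathbb R^m$ is twice continuously differentiable on $U$, $F(\bar x)=0$, $\varphi(x)=\varphi(\bar x)+\sigma_Q(F(x))$ for all $x\in U$, and the following hold: 1. (Robinson's condition) $0\in\mathrm{int}\{F(\bar x)+DF(\bar x)\mathbb R^n-\mathrm{dom}(\sigma_Q)\}$; 2. (strict condition) $DF(\bar x)\mathbb R^n-N_Q(\bar\lambda)=\mathbb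 R^m$; 3. (USOTP property of $Q$ at $\bar\lambda$) there are constants $\delta,M>0$, a neighborhood $V$ of $\bar\lambda$ and linear subspaces $S(\lambda)\subseteq\mathrm{lin}(T_Q(\lambda))$ for $\lambda\in Q\cap V$ such that $S(\lambda)\to\mathrm{lin}(T_Q(\bar\lambda))$ as $Q\ni\lambda\to\bar\lambda$, and such that for all $\lambda\in Q\cap V$ and all $v\in S(\lambda)$ with $\|v\|=1$ there is a map $\xi:[0,\delta]\to Q$ of the form $\xi(t)=\lambda+tv+\tfrac12t^2r(t)$ with $\|r(t)\|\le M$ for all $t\in[0,\delta]$. **Theorem.** Let $\varphi$ be $C^2$-strictly $u$-decomposable at $\bar x$ for $\bar\lambda$ with decomposition pair $(\sigma_Q,F)$. Then $$\mathrm d^2_s\varphi\big(\bar x\,\big|\,DF(\bar x)^\top\bar\lambda\big)(h)=\big\langle\bar\lambda,D^2F(\bar x)[h,h]\big\rangle+\iota_{\mathrm{aff}(DF(\bar x)^{-1}N_Q(\bar\lambda))}(h)\qquad\text{for all }h\in\mathbb R^n,$$ where $DF(\bar x)^{-1}N_Q(\bar\lambda)=\{u\in\mathbb R^n:DF(\bar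 x)u\in N_Q(\bar\lambda)\}$. -/

import Mathlib

open Filter Set Topology

noncomputable section

namespace StrictSub

section General

variable {ι E : Type*} [NormedAddCommGroup E]

/-- Painlevé–Kuratowski outer limit of the sets `C i` along the filter `l`. -/
def outerLimit (l : Filter ι) (C : ι → Set E) : Set E :=
  {x | ∀ ε : ℝ, 0 < ε → ∃ᶠ i in l, ∃ y ∈ C i, ‖y - x‖ < ε}

/-- Painlevé–Kuratowski inner limit of the sets `C i` along the filter `l`. -/
def innerLimit (l : Filter ι) (C : ι → Set E) : Set E :=
  {x | ∀ ε : ℝ, 0 < ε → ∀ᶠ i in l, ∃ y ∈ C i, ‖y - x‖ < ε}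

/-- Painlevé–Kuratowski convergence `C i → L` along the filter `l`. -/
def SetConverges (l : Filter ι) (C : ι → Set E) (L : Set E) : Prop :=
  outerLimit l C = L ∧ innerLimit l C = L

open Classical in
/-- The indicator function `ι_C` of convex analysis: `0` on `C`, `+∞` off `C`. -/
def indicatorFun (C : Set E) (x : E) : EReal := if x ∈ C then 0 else ⊤

variable [InnerProductSpace ℝ E]

/-- Effective domain. -/
def effDom (θ : E → EReal) : Set E := {x | θ x < ⊤}

/-- The support function `σ_Q(y) = sup_{q ∈ Q} ⟨q, y⟩`. -/
def supportFun (Q : Set E) (y : E) : EReal := ⨆ q ∈ Q, ((inner ℝ q y : ℝ) : EReal)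

/-- The tangent cone `T_C(x) = limsup_{t ↓ 0} (C - x) / t`. -/
def tangentCone (C : Set E) (x : E) : Set E :=
  outerLimit (𝓝[>] (0 : ℝ)) (fun t => {w | x + t • w ∈ C})

/-- The polar cone. -/
def polarCone (K : Set E) : Set E := {v | ∀ w ∈ K, inner ℝ v w ≤ 0}

/-- The normal cone (of a convex set), the polar of the tangent cone. -/
def normalCone (C : Set E) (x : E) : Set E := polarCone (tangentCone C x)

/-- The lineality space `lin(K) = K ∩ -K` of a convex cone. -/
def lineality (K : Set E) : Set E := {v | v ∈ K ∧ -v ∈ K}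

/-- The regular subdifferential: `θ(y) ≥ θ(x) + ⟨v, y - x⟩ + o(‖y - x‖)`, empty where `θ(x)` is
not finite. -/
def regularSubdiff (θ : E → EReal) (x : E) : Set E :=
  {v | θ x ≠ ⊤ ∧ θ x ≠ ⊥ ∧ ∀ ε : ℝ, 0 < ε →
    ∀ᶠ y in 𝓝 x, θ x + ((inner ℝ v (y - x) - ε * ‖y - x‖ : ℝ) : EReal) ≤ θ y}

/-- The (limiting) subdifferential: the outer limit of the regular subdifferentials at `y`, as
`y → x` with `θ(y) → θ(x)`; empty where `θ(x)` is not finite. -/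
def subdiff (θ : E → EReal) (x : E) : Set E :=
  {v | θ x ≠ ⊤ ∧ θ x ≠ ⊥ ∧
    v ∈ outerLimit (𝓝 x ⊓ comap θ (𝓝 (θ x))) (fun y => regularSubdiff θ y)}

/-- The second-order difference quotient
`Δ²_t θ(x|v)(h) = (θ(x + t h) - θ(x) - t ⟨v, h⟩) / (t² / 2)`. -/
def secondQuotient (θ : E → EReal) (t : ℝ) (x v h : E) : EReal :=
  (θ (x + t • h) - θ x - ((t * inner ℝ v h : ℝ) : EReal)) / ((t ^ 2 / 2 : ℝ) : EReal)

/-- The strict second subderivative `d²ₛθ(x₀|v₀)(h)`: the lower limit of `Δ²_t θ(x|v)(h')` as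
`t ↓ 0`, `h' → h`, and `(x, v) → (x₀, v₀)` in the graph of `∂θ` with `θ(x) → θ(x₀)`. -/
def strictSecondSubderiv (θ : E → EReal) (x₀ v₀ h : E) : EReal :=
  liminf (fun p : (ℝ × E) × (E × E) => secondQuotient θ p.1.1 p.2.1 p.2.2 p.1.2)
    ((𝓝[>] (0 : ℝ) ×ˢ 𝓝 h) ×ˢ
      (𝓝[{q : E × E | q.2 ∈ subdiff θ q.1}] (x₀, v₀) ⊓
        comap (fun q : E × E => θ q.1) (𝓝 (θ x₀))))

/-- The uniform second-order tangent path property of the set `Q` at `lam₀`. -/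
def HasUSOTP (Q : Set E) (lam₀ : E) : Prop :=
  ∃ δ : ℝ, 0 < δ ∧ ∃ M : ℝ, 0 < M ∧ ∃ V ∈ 𝓝 lam₀, ∃ S : E → Submodule ℝ E,
    (∀ lam ∈ Q ∩ V, (S lam : Set E) ⊆ lineality (tangentCone Q lam)) ∧
    SetConverges (𝓝[Q] lam₀) (fun lam => (S lam : Set E)) (lineality (tangentCone Q lam₀)) ∧
    ∀ lam ∈ Q ∩ V, ∀ v ∈ S lam, ‖v‖ = 1 →
      ∃ ξ r : ℝ → E, ∀ t ∈ Icc (0 : ℝ) δ,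
        ξ t ∈ Q ∧ ξ t = lam + t • v + (t ^ 2 / 2) • r t ∧ ‖r t‖ ≤ M

end General

section Decomposable

variable {E G : Type*} [NormedAddCommGroup E] [InnerProductSpace ℝ E]
  [NormedAddCommGroup G] [InnerProductSpace ℝ G]

/-- `φ` is `C^ℓ`-decomposable at `x₀` with decomposition pair `(σ_Q, F)`. Only the values of `F`
on the neighbourhood `U` matter. -/
structure IsDecomposable (ℓ : ℕ) (φ : E → EReal) (x₀ : E) (Q : Set G) (F : E → G) : Prop where
  mem_dom : x₀ ∈ effDom φ
  nonempty : Q.Nonempty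
  closed : IsClosed Q
  convex : Convex ℝ Q
  decomp : ∃ U : Set E, IsOpen U ∧ x₀ ∈ U ∧ ContDiffOn ℝ ℓ F U ∧
    ∀ x ∈ U, φ x = φ x₀ + supportFun Q (F x)
  map_base : F x₀ = 0
  /-- Robinson's constraint qualification. -/
  robinson : (0 : G) ∈ interior
    {y | ∃ u : E, ∃ z ∈ effDom (supportFun Q), y = F x₀ + fderiv ℝ F x₀ u - z}

/-- `φ` is `C^ℓ`-strictly decomposable at `x₀` for `lam₀`, with decomposition pair `(σ_Q, F)`:
in addition `DF(x₀) E - N_Q(lam₀)` is the whole space. -/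
structure IsStrictlyDecomposable (ℓ : ℕ) (φ : E → EReal) (x₀ : E) (lam₀ : G) (Q : Set G)
    (F : E → G) : Prop extends IsDecomposable ℓ φ x₀ Q F where
  mem_support : lam₀ ∈ Q
  strict : {y : G | ∃ u : E, ∃ z ∈ normalCone Q lam₀, y = fderiv ℝ F x₀ u - z} = univ

/-- `φ` is `C^ℓ`-strictly `u`-decomposable at `x₀` for `lam₀`, with decomposition pair
`(σ_Q, F)`. -/
structure IsStrictlyUDecomposable (ℓ : ℕ) (φ : E → EReal) (x₀ : E) (lam₀ : G) (Q : Set G)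
    (F : E → G) : Prop extends IsStrictlyDecomposable ℓ φ x₀ lam₀ Q F where
  usotp : HasUSOTP Q lam₀

end Decomposable

end StrictSub

end

/-! Write `v₀` for `DF(x₀)ᵀ lam₀` and `K` for the normal cone of `Q` at `lam₀`. Near `(x₀, v₀)` a
subgradient `v` of `φ` at `x` has the form `DF(x)ᵀ lam` with `lam ∈ Q` and `F x ∈ N_Q(lam)`, and the
strict condition forces `lam → lam₀` (`exists_tendsto_multiplier`). Then `φ x = r + ⟨lam, F x⟩`,
while `φ (x + t h') ≥ r + ⟨q, F (x + t h')⟩` for every `q ∈ Q`. Everything follows from the choice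
of `q`.

With `q = lam` the second-order quotient is at least `⟨lam, ·⟩` of the scaled Taylor remainder of
`F`, which tends to `⟨lam₀, D²F(x₀)[h,h]⟩` (`le_strictSecondSubderiv`).

If `DF(x₀) h` is outside `span K`, some `w ∈ lin T_Q(lam₀)` pairs to `1` with it. The tangent paths
of `Q` allow `q ≈ lam + A t w` up to a quadratic error, and this `q` gains about `2A` in the
quotient. As `A` is arbitrary, the value is `⊤` (`strictSecondSubderiv_eq_top`).

If `DF(x₀) h ∈ span K`, two curves through `x₀`, whose velocities differ by a multiple of `h`, are
mapped by `F` into `K`. There `σ_Q = ⟨lam₀, ·⟩`, so the quotient between the curves is exactly a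
Taylor quotient and the lower bound is attained (`strictSecondSubderiv_le`). Finally, `DF(x₀) h ∈
span K` says that `h` lies in the affine hull of `DF(x₀)⁻¹ K` (`mem_affineSpan_preimage_iff`). -/

namespace StrictSub

/-! ### Tangent cones, normal cones and support functions of convex sets -/

section Cones

variable {G : Type*} [NormedAddCommGroup G] [InnerProductSpace ℝ G]

theorem sub_mem_tangentCone {Q : Set G} (hQ : Convex ℝ Q) {x q : G} (hx : x ∈ Q) (hq : q ∈ Q) :
    q - x ∈ tangentCone Q x := by
  intro ε hε
  refine Eventually.frequently ?_
  filter_upwards [Ioo_mem_nhdsGT (zero_lt_one (α := ℝ))] with t ht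
  exact ⟨q - x, hQ.add_smul_sub_mem hx hq ⟨ht.1.le, ht.2.le⟩, by simpa using hε⟩

theorem mem_normalCone_iff {Q : Set G} (hQ : Convex ℝ Q) {x : G} (hx : x ∈ Q) {z : G} :
    z ∈ normalCone Q x ↔ ∀ q ∈ Q, inner ℝ z (q - x) ≤ 0 := by
  refine ⟨fun h q hq => h _ (sub_mem_tangentCone hQ hx hq), fun h w hw => ?_⟩
  refine le_of_forall_pos_le_add fun ε hε => ?_
  have hz : 0 < ‖z‖ + 1 := by positivity
  obtain ⟨t, ⟨y, hy, hyw⟩, ht⟩ :=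
    ((hw (ε / (‖z‖ + 1)) (by positivity)).and_eventually self_mem_nhdsWithin).exists
  have h1 : inner ℝ z y ≤ 0 := by
    have := h _ hy
    rw [add_sub_cancel_left, inner_smul_right] at this
    exact nonpos_of_mul_nonpos_right this ht
  have h2 : inner ℝ z (w - y) ≤ ‖z‖ * ‖w - y‖ := real_inner_le_norm _ _
  rw [inner_sub_right] at h2
  rw [lt_div_iff₀ hz, norm_sub_rev] at hyw
  nlinarith [norm_nonneg (w - y)]

/-- Bipolar theorem: a `w` outside the closure of the cone generated by `Q - x` is separated from it
by a functional whose Riesz representative is a normal vector with positive pairing with `w`. -/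
theorem mem_tangentCone_of_forall_normalCone [CompleteSpace G] {Q : Set G} (hQ : Convex ℝ Q)
    {x w : G} (hx : x ∈ Q) (hw : ∀ z ∈ normalCone Q x, inner ℝ z w ≤ 0) :
    w ∈ tangentCone Q x := by
  set C : Set G := {y | ∃ s : ℝ, 0 ≤ s ∧ ∃ q ∈ Q, y = s • (q - x)} with hC
  have hconv : Convex ℝ C := by
    rintro _ ⟨s, hs, q, hq, rfl⟩ _ ⟨t, ht, p, hp, rfl⟩ a b ha hb hab
    rcases (add_nonneg (mul_nonneg ha hs) (mul_nonneg hb ht)).eq_or_lt with h0 | h0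
    · have h1 : a * s = 0 := by nlinarith [mul_nonneg ha hs, mul_nonneg hb ht]
      have h2 : b * t = 0 := by nlinarith [mul_nonneg ha hs, mul_nonneg hb ht]
      exact ⟨0, le_rfl, x, hx, by simp [smul_smul, h1, h2]⟩
    · refine ⟨a * s + b * t, h0.le, (a * s / (a * s + b * t)) • q + (b * t / (a * s + b * t)) • p,
        hQ hq hp (by positivity) (by positivity) (by field_simp), ?_⟩
      have e1 : (a * s + b * t) * (a * s / (a * s + b * t)) = a * s := by field_simp
      have e2 : (a * s + b * t) * (b * t / (a * s + b * t)) = b * t := by field_simp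
      rw [smul_sub _ (_ + _) x, smul_add, smul_smul _ (a * s / _), smul_smul _ (b * t / _), e1, e2]
      module
  have hmem : w ∈ closure C := by
    by_contra hn
    obtain ⟨f, u, hf, hu⟩ := geometric_hahn_banach_closed_point hconv.closure isClosed_closure hn
    have h0 : 0 < u := by
      simpa using hf 0 (subset_closure ⟨0, le_rfl, x, hx, by simp⟩)
    have hz : (InnerProductSpace.toDual ℝ G).symm f ∈ normalCone Q x := by
      rw [mem_normalCone_iff hQ hx]
      intro q hq
      rw [InnerProductSpace.toDual_symm_apply]
      by_contra! hpos
      -- This multiple of `q - x` has `f`-value exactly `u`, against the strict separation.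
      have := hf _ (subset_closure ⟨u / f (q - x), by positivity, q, hq, rfl⟩)
      rw [map_smul, smul_eq_mul, div_mul_cancel₀ _ hpos.ne'] at this
      exact lt_irrefl _ this
    have := hw _ hz
    rw [InnerProductSpace.toDual_symm_apply] at this
    linarith
  intro ε hε
  obtain ⟨_, ⟨s, hs, q, hq, rfl⟩, hd⟩ := Metric.mem_closure_iff.1 hmem ε hε
  refine Eventually.frequently ?_
  have : ∀ᶠ t in 𝓝[>] (0 : ℝ), t * s < 1 := by
    refine (Tendsto.mono_left ?_ nhdsWithin_le_nhds).eventually (gt_mem_nhds zero_lt_one)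
    simpa using (continuous_id.mul continuous_const).tendsto (0 : ℝ) (f := fun t : ℝ => t * s)
  filter_upwards [this, self_mem_nhdsWithin] with t ht ht0
  refine ⟨s • (q - x), ?_, by rwa [← dist_eq_norm, dist_comm]⟩
  rw [smul_smul]
  exact hQ.add_smul_sub_mem hx hq ⟨mul_nonneg (le_of_lt ht0) hs, ht.le⟩

theorem normalCone_add {Q : Set G} {x a b : G} (ha : a ∈ normalCone Q x)
    (hb : b ∈ normalCone Q x) : a + b ∈ normalCone Q x := fun w hw => by
  rw [inner_add_left]; exact add_nonpos (ha w hw) (hb w hw)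

theorem normalCone_smul {Q : Set G} {x a : G} {t : ℝ} (ht : 0 ≤ t) (ha : a ∈ normalCone Q x) :
    t • a ∈ normalCone Q x := fun w hw => by
  rw [real_inner_smul_left]; exact mul_nonpos_of_nonneg_of_nonpos ht (ha w hw)

theorem zero_mem_normalCone (Q : Set G) (x : G) : (0 : G) ∈ normalCone Q x := fun w _ => by simp

theorem convex_normalCone (Q : Set G) (x : G) : Convex ℝ (normalCone Q x) :=
  fun _ ha _ hb _ _ hs ht _ => normalCone_add (normalCone_smul hs ha) (normalCone_smul ht hb)

theorem mem_lineality_of_mem_orthogonal [CompleteSpace G] {Q : Set G} (hQ : Convex ℝ Q) {x w : G}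
    (hx : x ∈ Q) (hw : w ∈ (Submodule.span ℝ (normalCone Q x))ᗮ) :
    w ∈ lineality (tangentCone Q x) := by
  have h : ∀ z ∈ normalCone Q x, inner ℝ z w = 0 := fun z hz =>
    (Submodule.mem_orthogonal _ w).1 hw z (Submodule.subset_span hz)
  exact ⟨mem_tangentCone_of_forall_normalCone hQ hx fun z hz => (h z hz).le,
    mem_tangentCone_of_forall_normalCone hQ hx fun z hz => by simp [h z hz]⟩

theorem supportFun_eq_of_mem_normalCone {Q : Set G} (hQ : Convex ℝ Q) {x z : G} (hx : x ∈ Q)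
    (hz : z ∈ normalCone Q x) : supportFun Q z = ((inner ℝ x z : ℝ) : EReal) := by
  refine le_antisymm (iSup₂_le fun q hq => ?_) (le_iSup₂ (f := fun q (_ : q ∈ Q) =>
    ((inner ℝ q z : ℝ) : EReal)) x hx)
  have := (mem_normalCone_iff hQ hx).1 hz q hq
  rw [inner_sub_right, real_inner_comm, real_inner_comm x] at this
  exact_mod_cast sub_nonpos.1 this

theorem le_supportFun {Q : Set G} {q : G} (hq : q ∈ Q) (z : G) :
    ((inner ℝ q z : ℝ) : EReal) ≤ supportFun Q z :=
  le_iSup₂ (f := fun q (_ : q ∈ Q) => ((inner ℝ q z : ℝ) : EReal)) q hq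

end Cones

/-! ### Stability of multipliers under the strict condition -/

section Strict

variable {E G : Type*} [NormedAddCommGroup E] [InnerProductSpace ℝ E] [CompleteSpace E]
  [NormedAddCommGroup G] [InnerProductSpace ℝ G] [FiniteDimensional ℝ G] [CompleteSpace G]

/-- Dual form of the strict condition. Writing `y = z - A u` with `z` normal, the `z` part pairs
nonpositively with `lam - lam₀` and the rest is controlled by `‖u‖`; applying this to `±` an
orthonormal basis bounds the norm. -/
theorem exists_norm_sub_le_norm_adjoint {Q : Set G} (hQ : Convex ℝ Q) {lam₀ : G} (hl : lam₀ ∈ Q)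
    (A : E →L[ℝ] G) (hA : {y : G | ∃ u : E, ∃ z ∈ normalCone Q lam₀, y = A u - z} = univ) :
    ∃ C : ℝ, 0 < C ∧ ∀ lam ∈ Q, ‖lam - lam₀‖ ≤ C * ‖A.adjoint (lam - lam₀)‖ := by
  have key : ∀ y : G, ∃ c : ℝ, 0 ≤ c ∧ ∀ lam ∈ Q,
      inner ℝ y (lam - lam₀) ≤ c * ‖A.adjoint (lam - lam₀)‖ := by
    intro y
    obtain ⟨u, z, hz, h⟩ : -y ∈ {y : G | ∃ u : E, ∃ z ∈ normalCone Q lam₀, y = A u - z} :=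
      hA ▸ mem_univ _
    refine ⟨‖u‖, norm_nonneg _, fun lam hlam => ?_⟩
    have h1 := (mem_normalCone_iff hQ hl).1 hz lam hlam
    have h2 : y = z - A u := by rw [← neg_eq_iff_eq_neg.2 (neg_sub z (A u)).symm, ← h, neg_neg]
    have h3 : inner ℝ (-u) (A.adjoint (lam - lam₀)) ≤ ‖-u‖ * ‖A.adjoint (lam - lam₀)‖ :=
      real_inner_le_norm _ _
    rw [ContinuousLinearMap.adjoint_inner_right, map_neg, inner_neg_left, norm_neg] at h3
    rw [h2, inner_sub_left]
    linarith
  choose c hc0 hc using key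
  let b := stdOrthonormalBasis ℝ G
  refine ⟨∑ i, (c (b i) + c (-b i)) + 1, ?_, fun lam hlam => ?_⟩
  · have : 0 ≤ ∑ i, (c (b i) + c (-b i)) :=
      Finset.sum_nonneg fun i _ => add_nonneg (hc0 _) (hc0 _)
    linarith
  · have h1 : ‖lam - lam₀‖ ≤ ∑ i, |inner ℝ (b i) (lam - lam₀)| := by
      conv_lhs => rw [← b.sum_repr' (lam - lam₀)]
      refine (norm_sum_le _ _).trans (Finset.sum_le_sum fun i _ => ?_)
      rw [norm_smul, b.norm_eq_one, mul_one, Real.norm_eq_abs]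
    have h2 : ∑ i, |inner ℝ (b i) (lam - lam₀)| ≤
        ∑ i, (c (b i) + c (-b i)) * ‖A.adjoint (lam - lam₀)‖ := by
      refine Finset.sum_le_sum fun i _ => ?_
      have h3 := hc (b i) lam hlam
      have h4 := hc (-b i) lam hlam
      rw [inner_neg_left] at h4
      have := norm_nonneg (A.adjoint (lam - lam₀))
      rw [abs_le]
      constructor <;> nlinarith [mul_nonneg (hc0 (b i)) this, mul_nonneg (hc0 (-b i)) this]
    rw [← Finset.sum_mul] at h2
    nlinarith [norm_nonneg (A.adjoint (lam - lam₀))]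

theorem exists_multiplier_close {Q : Set G} (hQ : Convex ℝ Q) {lam₀ : G} (hl : lam₀ ∈ Q)
    (A : E →L[ℝ] G) (hA : {y : G | ∃ u : E, ∃ z ∈ normalCone Q lam₀, y = A u - z} = univ)
    {ε : ℝ} (hε : 0 < ε) :
    ∃ δ : ℝ, 0 < δ ∧ ∀ B : E →L[ℝ] G, ‖B - A‖ < δ → ∀ lam ∈ Q,
      ‖B.adjoint lam - A.adjoint lam₀‖ < δ → ‖lam - lam₀‖ < ε := by
  obtain ⟨C, hC, h⟩ := exists_norm_sub_le_norm_adjoint hQ hl A hA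
  have hl0 : 0 < ‖lam₀‖ + 1 := by positivity
  -- The first bound lets the term `C δ ‖lam - lam₀‖` be absorbed on the left; the second makes what
  -- remains at most `ε`.
  refine ⟨min (1 / (2 * C)) (ε / (2 * C * (‖lam₀‖ + 1))), by positivity,
    fun B hB lam hlam hd => ?_⟩
  set δ := min (1 / (2 * C)) (ε / (2 * C * (‖lam₀‖ + 1)))
  have hδ1 : C * δ ≤ 1 / 2 := by
    have : δ ≤ 1 / (2 * C) := min_le_left _ _
    rw [le_div_iff₀ (by positivity)] at this
    linarith
  have hδ2 : 2 * C * (‖lam₀‖ + 1) * δ ≤ ε := by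
    have : δ ≤ ε / (2 * C * (‖lam₀‖ + 1)) := min_le_right _ _
    rw [le_div_iff₀ (by positivity)] at this
    linarith
  have e : A.adjoint (lam - lam₀) =
      (B.adjoint lam - A.adjoint lam₀) - (B - A).adjoint (lam - lam₀) - (B - A).adjoint lam₀ := by
    simp only [map_sub, sub_apply]; abel
  have h1 : ‖(B - A).adjoint (lam - lam₀)‖ ≤ ‖B - A‖ * ‖lam - lam₀‖ := by
    rw [← ContinuousLinearMap.adjoint.norm_map (B - A)]
    exact ContinuousLinearMap.le_opNorm _ _
  have h2 : ‖(B - A).adjoint lam₀‖ ≤ ‖B - A‖ * ‖lam₀‖ := by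
    rw [← ContinuousLinearMap.adjoint.norm_map (B - A)]
    exact ContinuousLinearMap.le_opNorm _ _
  have h3 : ‖A.adjoint (lam - lam₀)‖ < δ + δ * ‖lam - lam₀‖ + δ * ‖lam₀‖ := by
    rw [e]
    have := norm_sub_le ((B.adjoint lam - A.adjoint lam₀) - (B - A).adjoint (lam - lam₀))
      ((B - A).adjoint lam₀)
    have := norm_sub_le (B.adjoint lam - A.adjoint lam₀) ((B - A).adjoint (lam - lam₀))
    nlinarith [norm_nonneg (lam - lam₀), norm_nonneg lam₀]
  have h4 := h lam hlam
  have h5 : C * ‖A.adjoint (lam - lam₀)‖ < C * (δ + δ * ‖lam - lam₀‖ + δ * ‖lam₀‖) := by gcongr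
  nlinarith [norm_nonneg (lam - lam₀), mul_le_mul_of_nonneg_right hδ1 (norm_nonneg (lam - lam₀))]

end Strict

/-! ### The Moreau envelope of a support function -/

section Moreau

variable {G : Type*} [NormedAddCommGroup G] [InnerProductSpace ℝ G] [CompleteSpace G]

/-- The Moreau envelope `f` of parameter `μ` of the support function of `Q`, with its gradient `p`. -/
theorem exists_moreau_envelope {Q : Set G} (hne : Q.Nonempty) (hcl : IsClosed Q)
    (hQ : Convex ℝ Q) {μ : ℝ} (hμ : 0 < μ) :
    ∃ (p : G → G) (f : G → ℝ), (∀ z, p z ∈ Q) ∧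
      (∀ z, ∀ q ∈ Q, inner ℝ q z - μ / 2 * ‖q‖ ^ 2 ≤ f z) ∧
      (∀ z, f z = inner ℝ (p z) z - μ / 2 * ‖p z‖ ^ 2) ∧
      (∀ z, ∀ q ∈ Q, inner ℝ (z - μ • p z) (q - p z) ≤ 0) ∧
      ∀ z, HasFDerivAt f (innerSL ℝ (p z)) z := by
  have hex : ∀ z : G, ∃ p ∈ Q, ∀ q ∈ Q, inner ℝ (z - μ • p) (q - p) ≤ 0 := by
    intro z
    obtain ⟨p, hp, h⟩ := exists_norm_eq_iInf_of_complete_convex hne hcl.isComplete hQ (μ⁻¹ • z)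
    refine ⟨p, hp, fun q hq => ?_⟩
    have h1 := (norm_eq_iInf_iff_real_inner_le_zero hQ hp).1 h q hq
    have h2 : z - μ • p = μ • (μ⁻¹ • z - p) := by
      rw [smul_sub, smul_smul, mul_inv_cancel₀ hμ.ne', one_smul]
    rw [h2, real_inner_smul_left]
    exact mul_nonpos_of_nonneg_of_nonpos hμ.le h1
  choose p hpQ hp using hex
  let f : G → ℝ := fun z => inner ℝ (p z) z - μ / 2 * ‖p z‖ ^ 2
  have hf : ∀ z, f z = inner ℝ (p z) z - μ / 2 * ‖p z‖ ^ 2 := fun _ => rfl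
  -- Strong concavity in `q` of the maximised function. Used at two points `z`, `z'`, it squeezes `f
  -- z'` between its linearisation at `z` and a quadratic perturbation of it.
  have key : ∀ z, ∀ q ∈ Q,
      inner ℝ q z - μ / 2 * ‖q‖ ^ 2 ≤ f z - μ / 2 * ‖q - p z‖ ^ 2 := by
    intro z q hq
    have h := hp z q hq
    rw [inner_sub_left, real_inner_smul_left, inner_sub_right, inner_sub_right,
      real_inner_self_eq_norm_sq, real_inner_comm q z, real_inner_comm (p z) z] at h
    rw [hf, norm_sub_sq_real, real_inner_comm (p z) q]
    nlinarith
  refine ⟨p, f, hpQ, fun z q hq => (key z q hq).trans ?_, hf, hp, fun z => ?_⟩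
  · have : 0 ≤ μ / 2 * ‖q - p z‖ ^ 2 := by positivity
    linarith
  · refine HasFDerivAt.of_isLittleO ?_
    have hbound : ∀ z', ‖f z' - f z - innerSL ℝ (p z) (z' - z)‖ ≤ 1 / (2 * μ) * ‖z' - z‖ ^ 2 := by
      intro z'
      have h1 := key z' (p z) (hpQ z)
      have h2 := key z (p z') (hpQ z')
      have h0 : 0 ≤ μ / 2 * ‖p z - p z'‖ ^ 2 := by positivity
      rw [innerSL_apply_apply, Real.norm_eq_abs, abs_of_nonneg, inner_sub_right]
      · have h3 : inner ℝ (p z' - p z) (z' - z) ≤ ‖p z' - p z‖ * ‖z' - z‖ :=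
          real_inner_le_norm _ _
        have h4 : ‖p z' - p z‖ * ‖z' - z‖ ≤
            μ / 2 * ‖p z' - p z‖ ^ 2 + 1 / (2 * μ) * ‖z' - z‖ ^ 2 := by
          have e : μ / 2 * ‖p z' - p z‖ ^ 2 + 1 / (2 * μ) * ‖z' - z‖ ^ 2
              - ‖p z' - p z‖ * ‖z' - z‖ = (μ * ‖p z' - p z‖ - ‖z' - z‖) ^ 2 / (2 * μ) := by
            field_simp; ring
          have : 0 ≤ (μ * ‖p z' - p z‖ - ‖z' - z‖) ^ 2 / (2 * μ) := by positivity
          linarith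
        rw [inner_sub_left, inner_sub_right, inner_sub_right] at h3
        have := hf z'
        linarith
      · have := hf z
        rw [inner_sub_right]
        linarith
    refine (Asymptotics.IsBigO.of_bound (1 / (2 * μ)) (Eventually.of_forall fun z' => ?_)).trans_isLittleO
      (?_ : (fun z' => ‖z' - z‖ ^ 2) =o[𝓝 z] fun z' => z' - z)
    · simpa using hbound z'
    · have h := Asymptotics.isLittleO_norm_pow_id (E' := G) one_lt_two
      exact h.comp_tendsto (tendsto_sub_nhds_zero_iff.2 tendsto_id)

end Moreau

theorem tendsto_clm_apply {ι E G : Type*} [NormedAddCommGroup E] [NormedSpace ℝ E]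
    [NormedAddCommGroup G] [NormedSpace ℝ G] {l : Filter ι} {A : ι → E →L[ℝ] G} {B : E →L[ℝ] G}
    {f : ι → E} {x : E} (hA : Tendsto A l (𝓝 B)) (hf : Tendsto f l (𝓝 x)) :
    Tendsto (fun i => A i (f i)) l (𝓝 (B x)) :=
  ((isBoundedBilinearMap_apply (𝕜 := ℝ) (E := E) (F := G)).continuous.tendsto (B, x)).comp
    (hA.prodMk_nhds hf)

/-! ### Subgradients of the composition have multipliers -/

section Multipliers

variable {E G : Type*} [NormedAddCommGroup E] [InnerProductSpace ℝ E]
  [CompleteSpace E] [NormedAddCommGroup G] [InnerProductSpace ℝ G] [CompleteSpace G]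

/-- Smoothing and penalisation: `σ_Q` is replaced by its Moreau envelope `f`, and `f ∘ F - ⟨v, · -
y⟩` plus a quadratic penalty is minimised on a small closed ball. The penalty keeps the minimiser
off the sphere, so stationarity there produces the multiplier `p (F x)`. -/
theorem exists_approx_multiplier_of_mem_regularSubdiff [FiniteDimensional ℝ E] {Q : Set G}
    (hne : Q.Nonempty) (hcl : IsClosed Q) (hQ : Convex ℝ Q) {φ : E → EReal} {r : ℝ} {F : E → G} {U : Set E}
    (hU : IsOpen U) (hF : DifferentiableOn ℝ F U)
    (hφ : ∀ x ∈ U, φ x = (r : EReal) + supportFun Q (F x)) {y v : E} (hy : y ∈ U)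
    (hv : v ∈ regularSubdiff φ y) {η : ℝ} (hη : 0 < η) :
    ∃ (x : E) (lam : G) (μ : ℝ), ‖x - y‖ < η ∧ 0 < μ ∧ μ < η ∧ lam ∈ Q ∧
      ‖(fderiv ℝ F x).adjoint lam - v‖ < η ∧ ∀ q ∈ Q, inner ℝ (F x - μ • lam) (q - lam) ≤ 0 := by
  obtain ⟨htop, hbot, hreg⟩ := hv
  rw [hφ y hy] at htop hbot
  have hs1 : supportFun Q (F y) ≠ ⊤ := fun h => htop (by rw [h, EReal.coe_add_top])
  have hs2 : supportFun Q (F y) ≠ ⊥ := fun h => hbot (by rw [h, EReal.add_bot])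
  obtain ⟨s, hs⟩ : ∃ s : ℝ, supportFun Q (F y) = s := ⟨_, (EReal.coe_toReal hs1 hs2).symm⟩
  -- At the minimiser the penalty has gradient of norm at most `4 * ε = η / 2`.
  set ε := η / 8 with hε
  have hε0 : 0 < ε := by positivity
  obtain ⟨ρ₀, hρ₀, hball⟩ := Metric.eventually_nhds_iff_ball.1 ((hreg ε hε0).and (hU.mem_nhds hy))
  set ρ := min (ρ₀ / 2) (η / 2) with hρ
  have hρpos : 0 < ρ := by positivity
  have hρη : ρ < η := (min_le_right _ _).trans_lt (by linarith)
  have hsub : ∀ x ∈ Metric.closedBall y ρ, x ∈ U ∧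
      ((s + (inner ℝ v (x - y) - ε * ‖x - y‖) : ℝ) : EReal) ≤ supportFun Q (F x) := by
    intro x hx
    obtain ⟨h1, h2⟩ := hball x (Metric.closedBall_subset_ball
      ((min_le_left _ _).trans_lt (by linarith)) hx)
    refine ⟨h2, ?_⟩
    rw [hφ x h2, hφ y hy, hs, add_assoc] at h1
    have := EReal.addLECancellable_coe r h1
    exact_mod_cast this
  have hcont : ∀ x ∈ Metric.closedBall y ρ, ContinuousAt F x := fun x hx =>
    (hF.differentiableAt (hU.mem_nhds (hsub x hx).1)).continuousAt
  -- The strict inequality holds at `μ = 0` and is open in `(μ, x)`, so compactness of the sphere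
  -- gives one `μ > 0` for all `x`.
  have hsphere : ∀ᶠ μ in 𝓝 (0 : ℝ), ∀ x ∈ Metric.sphere y ρ, ∃ q ∈ Q,
      s + inner ℝ v (x - y) - 2 * ε * ρ < inner ℝ q (F x) - μ / 2 * ‖q‖ ^ 2 := by
    refine (isCompact_sphere y ρ).eventually_forall_of_forall_eventually
      (P := fun μ x => ∃ q ∈ Q,
        s + inner ℝ v (x - y) - 2 * ε * ρ < inner ℝ q (F x) - μ / 2 * ‖q‖ ^ 2) fun x hx => ?_
    have hx' := Metric.sphere_subset_closedBall hx
    have hn : ‖x - y‖ = ρ := by rwa [← dist_eq_norm]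
    have h1 : ((s + inner ℝ v (x - y) - 2 * ε * ρ : ℝ) : EReal) < supportFun Q (F x) := by
      refine lt_of_lt_of_le ?_ (hsub x hx').2
      rw [hn, EReal.coe_lt_coe_iff]
      nlinarith [mul_pos hε0 hρpos]
    obtain ⟨q, hq⟩ := lt_iSup_iff.1 h1
    obtain ⟨hqQ, hq⟩ := lt_iSup_iff.1 hq
    rw [EReal.coe_lt_coe_iff] at hq
    have hc : ContinuousAt (fun z : ℝ × E => F z.2) ((0 : ℝ), x) :=
      ContinuousAt.comp (f := Prod.snd) (hcont x hx') continuousAt_snd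
    have hc1 : ContinuousAt (fun z : ℝ × E => s + inner ℝ v (z.2 - y) - 2 * ε * ρ) ((0 : ℝ), x) := by
      fun_prop
    have hc2 : ContinuousAt (fun z : ℝ × E => inner ℝ q (F z.2) - z.1 / 2 * ‖q‖ ^ 2)
        ((0 : ℝ), x) := by
      fun_prop
    filter_upwards [hc1.eventually_lt hc2 (by simpa using hq)] with z hz
    exact ⟨q, hqQ, hz⟩
  obtain ⟨μ, hμs, hμ0, hμη⟩ := ((hsphere.filter_mono nhdsWithin_le_nhds).and
    (Ioo_mem_nhdsGT hη)).exists
  obtain ⟨p, f, hpQ, hle, hfp, hp, hfd⟩ := exists_moreau_envelope hne hcl hQ hμ0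
  let g : E → ℝ := fun x => f (F x) - inner ℝ v (x - y) + 2 * ε / ρ * ‖x - y‖ ^ 2
  have hgd : ∀ x ∈ Metric.closedBall y ρ, HasFDerivAt g
      ((innerSL ℝ (p (F x))).comp (fderiv ℝ F x) - innerSL ℝ v +
        (2 * ε / ρ) • (2 • innerSL ℝ (x - y))) x := by
    intro x hx
    have h1 := (hfd (F x)).comp x (hF.differentiableAt (hU.mem_nhds (hsub x hx).1)).hasFDerivAt
    have h2 : HasFDerivAt (fun x => x - y) (ContinuousLinearMap.id ℝ E) x :=
      (hasFDerivAt_id x).sub_const y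
    have h3 := (innerSL ℝ v).hasFDerivAt.comp x h2
    have h4 := h2.norm_sq.const_mul (2 * ε / ρ)
    exact (h1.sub h3).add h4
  obtain ⟨x, hx, hmin⟩ := (isCompact_closedBall y ρ).exists_isMinOn
    (Metric.nonempty_closedBall.2 hρpos.le)
    (fun x hx => (hgd x hx).continuousAt.continuousWithinAt)
  have hgy : g y ≤ s := by
    have h1 : ((inner ℝ (p (F y)) (F y) : ℝ) : EReal) ≤ s := hs ▸ le_supportFun (hpQ _) (F y)
    rw [EReal.coe_le_coe_iff] at h1
    have : 0 ≤ μ / 2 * ‖p (F y)‖ ^ 2 := by positivity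
    simp only [g, sub_self, inner_zero_right, norm_zero, hfp]
    norm_num
    linarith
  have hxball : x ∈ Metric.ball y ρ := by
    by_contra hnb
    have hxs : x ∈ Metric.sphere y ρ := by
      rw [Metric.mem_ball, not_lt] at hnb
      exact le_antisymm hx hnb
    obtain ⟨q, hq, h1⟩ := hμs x hxs
    have h2 := hle (F x) q hq
    have hn : ‖x - y‖ = ρ := by rwa [← dist_eq_norm]
    have h3 : g x ≤ g y := hmin (Metric.mem_closedBall_self hρpos.le)
    have h4 : g x = f (F x) - inner ℝ v (x - y) + 2 * ε * ρ := by
      simp only [g, hn]; field_simp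
    linarith
  have hloc : IsLocalMin g x := hmin.isLocalMin
    (mem_of_superset (Metric.isOpen_ball.mem_nhds hxball) Metric.ball_subset_closedBall)
  have hzero := hloc.hasFDerivAt_eq_zero (hgd x hx)
  have hgrad : (fderiv ℝ F x).adjoint (p (F x)) - v = -((4 * ε / ρ) • (x - y)) := by
    refine ext_inner_right ℝ fun u => ?_
    have h := DFunLike.congr_fun hzero u
    simp only [add_apply, sub_apply, ContinuousLinearMap.comp_apply, innerSL_apply_apply,
      smul_apply, zero_apply, nsmul_eq_mul, smul_eq_mul] at h
    rw [inner_sub_left, ContinuousLinearMap.adjoint_inner_left, inner_neg_left,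
      real_inner_smul_left]
    push_cast at h
    linear_combination h
  rw [Metric.mem_closedBall, dist_eq_norm] at hx
  refine ⟨x, p (F x), μ, hx.trans_lt hρη, hμ0, hμη, hpQ _, ?_, hp _⟩
  rw [hgrad, norm_neg, norm_smul, Real.norm_of_nonneg (by positivity)]
  calc 4 * ε / ρ * ‖x - y‖ ≤ 4 * ε / ρ * ρ := by gcongr
    _ = η / 2 := by rw [hε]; field_simp; norm_num
    _ < η := by linarith

theorem exists_approx_multiplier_of_mem_subdiff [FiniteDimensional ℝ E] {Q : Set G}
    (hne : Q.Nonempty) (hcl : IsClosed Q) (hQ : Convex ℝ Q) {φ : E → EReal} {r : ℝ} {F : E → G} {U : Set E}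
    (hU : IsOpen U) (hF : DifferentiableOn ℝ F U)
    (hφ : ∀ x ∈ U, φ x = (r : EReal) + supportFun Q (F x)) {y v : E} (hy : y ∈ U)
    (hv : v ∈ subdiff φ y) {η : ℝ} (hη : 0 < η) :
    ∃ (x : E) (lam : G) (μ : ℝ), ‖x - y‖ < η ∧ 0 < μ ∧ μ < η ∧ lam ∈ Q ∧
      ‖(fderiv ℝ F x).adjoint lam - v‖ < η ∧ ∀ q ∈ Q, inner ℝ (F x - μ • lam) (q - lam) ≤ 0 := by
  have hη2 : 0 < η / 2 := by positivity
  have hnear : ∀ᶠ y' in 𝓝 y ⊓ comap φ (𝓝 (φ y)), y' ∈ U ∧ ‖y' - y‖ < η / 2 := by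
    refine Filter.Eventually.filter_mono inf_le_left ?_
    filter_upwards [hU.mem_nhds hy, Metric.ball_mem_nhds y hη2] with y' h1 h2
    exact ⟨h1, by rwa [← dist_eq_norm]⟩
  obtain ⟨y', ⟨v', hv', hvv⟩, hyU, hyy⟩ := ((hv.2.2 (η / 2) hη2).and_eventually hnear).exists
  obtain ⟨x, lam, μ, h1, h2, h3, h4, h5, h6⟩ :=
    exists_approx_multiplier_of_mem_regularSubdiff hne hcl hQ hU hF hφ hyU hv' hη2
  refine ⟨x, lam, μ, ?_, h2, by linarith, h4, ?_, h6⟩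
  · have := norm_sub_le_norm_sub_add_norm_sub x y' y
    linarith
  · have := norm_sub_le_norm_sub_add_norm_sub ((fderiv ℝ F x).adjoint lam) v' v
    linarith

/-- Near `(x₀, DF(x₀)ᵀ lam₀)` the chain rule `∂φ(x) ⊆ DF(x)ᵀ ∂σ_Q(F(x))` holds. -/
theorem eventually_exists_multiplier [FiniteDimensional ℝ E] [FiniteDimensional ℝ G] {Q : Set G}
    (hcl : IsClosed Q) (hQ : Convex ℝ Q) {lam₀ : G} (hl : lam₀ ∈ Q) {φ : E → EReal} {r : ℝ} {F : E → G} {U : Set E}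
    (hU : IsOpen U) (hF : ContDiffOn ℝ 2 F U)
    (hφ : ∀ x ∈ U, φ x = (r : EReal) + supportFun Q (F x)) {x₀ : E} (hx₀ : x₀ ∈ U)
    (hA : {y : G | ∃ u : E, ∃ z ∈ normalCone Q lam₀, y = fderiv ℝ F x₀ u - z} = univ) :
    ∀ᶠ q : E × E in 𝓝 (x₀, (fderiv ℝ F x₀).adjoint lam₀), q.2 ∈ subdiff φ q.1 →
      ∃ lam ∈ Q, q.2 = (fderiv ℝ F q.1).adjoint lam ∧ F q.1 ∈ normalCone Q lam := by
  obtain ⟨δ, hδ, hclose⟩ := exists_multiplier_close hQ hl _ hA zero_lt_one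
  have hDc : ∀ x ∈ U, ContinuousAt (fderiv ℝ F) x := fun x hx =>
    ((hF.contDiffAt (hU.mem_nhds hx)).fderiv_right (m := 1) (by norm_num)).continuousAt
  -- The inner quantifier is for the approximating points `X k`, which converge to `x` rather than
  -- to `x₀`.
  have hN1 : ∀ᶠ x in 𝓝 x₀, ∀ᶠ x' in 𝓝 x, ‖fderiv ℝ F x' - fderiv ℝ F x₀‖ < δ := by
    rw [eventually_eventually_nhds]
    have := (hDc x₀ hx₀).eventually (Metric.ball_mem_nhds _ hδ)
    filter_upwards [this] with x hx
    rwa [← dist_eq_norm]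
  rw [nhds_prod_eq]
  filter_upwards [(hN1.and (hU.eventually_mem hx₀)).prod_mk (Metric.ball_mem_nhds _ hδ)]
    with ⟨x, v⟩ ⟨⟨hx1, hxU⟩, hvb⟩ hv
  simp only at hx1 hxU hvb hv ⊢
  have hη : ∀ k : ℕ, (0 : ℝ) < 1 / ((k : ℝ) + 1) := fun k => by positivity
  choose X Λ μ h1 h2 h3 h4 h5 h6 using fun k : ℕ =>
    exists_approx_multiplier_of_mem_subdiff ⟨lam₀, hl⟩ hcl hQ hU (hF.differentiableOn (by norm_num))
      hφ hxU hv (hη k)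
  have hη0 : Tendsto (fun k : ℕ => 1 / ((k : ℝ) + 1)) atTop (𝓝 0) :=
    tendsto_one_div_add_atTop_nhds_zero_nat
  have hX : Tendsto X atTop (𝓝 x) := tendsto_iff_norm_sub_tendsto_zero.2
    (squeeze_zero (fun _ => norm_nonneg _) (fun k => (h1 k).le) hη0)
  have hμ : Tendsto μ atTop (𝓝 0) := squeeze_zero (fun k => (h2 k).le) (fun k => (h3 k).le) hη0
  have hw : Tendsto (fun k => (fderiv ℝ F (X k)).adjoint (Λ k)) atTop (𝓝 v) :=
    tendsto_iff_norm_sub_tendsto_zero.2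
      (squeeze_zero (fun _ => norm_nonneg _) (fun k => (h5 k).le) hη0)
  -- The strict condition bounds the approximate multipliers, so a subsequence converges; since `μ k
  -- → 0`, its limit is an exact multiplier.
  have hbd : ∀ᶠ k in atTop, Λ k ∈ Metric.ball lam₀ 1 := by
    filter_upwards [hX.eventually hx1, hw (Metric.isOpen_ball.mem_nhds hvb)] with k hk1 hk2
    rw [Metric.mem_ball, dist_eq_norm]
    refine hclose _ hk1 _ (h4 k) ?_
    rw [← dist_eq_norm]; exact hk2
  obtain ⟨lam, -, ψ, hψ, hlim⟩ :=
    tendsto_subseq_of_frequently_bounded Metric.isBounded_ball hbd.frequently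
  have hψ' := hψ.tendsto_atTop
  have hlamQ : lam ∈ Q := hcl.mem_of_tendsto hlim (Eventually.of_forall fun k => h4 _)
  refine ⟨lam, hlamQ, ?_, (mem_normalCone_iff hQ hlamQ).2 fun q hq => ?_⟩
  · refine tendsto_nhds_unique (hw.comp hψ') ?_
    have hD : Tendsto (fun k => (fderiv ℝ F (X (ψ k))).adjoint) atTop
        (𝓝 (fderiv ℝ F x).adjoint) :=
      (ContinuousLinearMap.adjoint.continuous.tendsto _).comp
        ((hDc x hxU).tendsto.comp (hX.comp hψ'))
    exact tendsto_clm_apply hD hlim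
  · have hFx : Tendsto (fun k => F (X (ψ k))) atTop (𝓝 (F x)) :=
      (hF.continuousOn.continuousAt (hU.mem_nhds hxU)).tendsto.comp (hX.comp hψ')
    have hlim' := (hFx.sub ((hμ.comp hψ').smul hlim)).inner (𝕜 := ℝ) (hlim.const_sub q)
    rw [zero_smul, sub_zero] at hlim'
    exact le_of_tendsto hlim' (Eventually.of_forall fun k => h6 _ q hq)

end Multipliers

/-! ### Second-order Taylor expansion with a moving base point -/

section Taylor

variable {E G : Type*} [NormedAddCommGroup E] [NormedSpace ℝ E]
  [NormedAddCommGroup G] [NormedSpace ℝ G]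

/-- Second-order Taylor expansion, uniform in the base point. -/
theorem exists_norm_taylor_le {F : E → G} {x₀ : E} (hF : ContDiffAt ℝ 2 F x₀) {ε : ℝ}
    (hε : 0 < ε) :
    ∃ δ : ℝ, 0 < δ ∧ ∀ x k : E, ‖x - x₀‖ < δ → ‖k‖ < δ →
      ‖F (x + k) - F x - fderiv ℝ F x k - (1 / 2 : ℝ) • fderiv ℝ (fderiv ℝ F) x₀ k k‖ ≤
        ε * ‖k‖ ^ 2 := by
  have hD : HasStrictFDerivAt (fderiv ℝ F) (fderiv ℝ (fderiv ℝ F) x₀) x₀ :=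
    (hF.fderiv_right (m := 1) (by norm_num)).hasStrictFDerivAt (by norm_num)
  set D := fderiv ℝ (fderiv ℝ F) x₀ with hDdef
  have h1 := hD.isLittleO.def hε
  have h2 : ∀ᶠ x in 𝓝 x₀, DifferentiableAt ℝ F x :=
    (hF.eventually (by norm_num)).mono fun x hx => hx.differentiableAt (by norm_num)
  rw [nhds_prod_eq] at h1
  obtain ⟨δ, hδ, hb⟩ := Metric.eventually_nhds_iff_ball.1 (h1.diag_of_prod.and h2)
  obtain ⟨δ', hδ', hb'⟩ : ∃ δ' > 0, ∀ a ∈ Metric.ball x₀ δ', ∀ b ∈ Metric.ball x₀ δ',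
      ‖fderiv ℝ F a - fderiv ℝ F b - D (a - b)‖ ≤ ε * ‖a - b‖ := by
    obtain ⟨s, hs, hs'⟩ := (eventually_prod_self_iff (r := fun a b =>
      ‖fderiv ℝ F a - fderiv ℝ F b - D (a - b)‖ ≤ ε * ‖a - b‖)).1 h1
    obtain ⟨δ', hδ', hsub⟩ := Metric.mem_nhds_iff.1 hs
    exact ⟨δ', hδ', fun a ha b hb => hs' a (hsub ha) b (hsub hb)⟩
  refine ⟨min δ δ' / 2, by positivity, fun x k hx hk => ?_⟩
  have hmem : ∀ s ∈ Icc (0 : ℝ) 1, ‖x + s • k - x₀‖ < min δ δ' := by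
    intro s hs
    have e : x + s • k - x₀ = (x - x₀) + s • k := by abel
    have h3 : ‖s • k‖ ≤ ‖k‖ := by
      rw [norm_smul, Real.norm_of_nonneg hs.1]
      exact mul_le_of_le_one_left (norm_nonneg _) hs.2
    rw [e]
    have := norm_add_le (x - x₀) (s • k)
    linarith
  have hball : ∀ s ∈ Icc (0 : ℝ) 1, x + s • k ∈ Metric.ball x₀ δ ∧ x + s • k ∈ Metric.ball x₀ δ' :=
    fun s hs => by
      rw [Metric.mem_ball, Metric.mem_ball, dist_eq_norm]
      exact lt_min_iff.1 (hmem s hs)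
  have hxb : x ∈ Metric.ball x₀ δ' := by
    simpa using (hball 0 ⟨le_rfl, zero_le_one⟩).2
  -- Mean value inequality along the segment: strict differentiability of `DF` at `x₀` bounds this
  -- derivative by `ε * ‖k‖ ^ 2`, uniformly in `x`.
  have hder : ∀ s ∈ Icc (0 : ℝ) 1, HasDerivWithinAt
      (fun s : ℝ => F (x + s • k) - s • fderiv ℝ F x k - (s ^ 2 / 2) • D k k)
      (fderiv ℝ F (x + s • k) k - fderiv ℝ F x k - s • D k k) (Icc 0 1) s := by
    intro s hs
    have d1 : HasDerivAt (fun s : ℝ => x + s • k) k s := by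
      simpa using ((hasDerivAt_id s).smul_const k).const_add x
    have d2 := ((hb _ (hball s hs).1).2.hasFDerivAt).comp_hasDerivAt s d1
    have d3 : HasDerivAt (fun s : ℝ => s • fderiv ℝ F x k) (fderiv ℝ F x k) s := by
      simpa using (hasDerivAt_id s).smul_const (fderiv ℝ F x k)
    have d4 : HasDerivAt (fun s : ℝ => (s ^ 2 / 2) • D k k) (s • D k k) s := by
      have := ((hasDerivAt_pow 2 s).div_const 2).smul_const (D k k)
      convert this using 2
      norm_num
    exact ((d2.sub d3).sub d4).hasDerivWithinAt
  have hbound := norm_image_sub_le_of_norm_deriv_le_segment_01' (C := ε * ‖k‖ ^ 2) hder ?_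
  · convert hbound using 2
    simp only [one_smul, zero_smul, add_zero]
    norm_num
    abel
  · intro s hs
    have hs' : s ∈ Icc (0 : ℝ) 1 := ⟨hs.1, hs.2.le⟩
    have h3 := hb' _ (hball s hs').2 x hxb
    rw [add_sub_cancel_left] at h3
    have e : fderiv ℝ F (x + s • k) k - fderiv ℝ F x k - s • D k k =
        (fderiv ℝ F (x + s • k) - fderiv ℝ F x - D (s • k)) k := by
      simp
    have h4 : ‖s • k‖ ≤ ‖k‖ := by
      rw [norm_smul, Real.norm_of_nonneg hs.1]
      exact mul_le_of_le_one_left (norm_nonneg _) hs'.2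
    rw [e]
    calc _ ≤ ‖fderiv ℝ F (x + s • k) - fderiv ℝ F x - D (s • k)‖ * ‖k‖ :=
          ContinuousLinearMap.le_opNorm _ _
      _ ≤ (ε * ‖k‖) * ‖k‖ := by
          gcongr
          exact h3.trans (by gcongr)
      _ = ε * ‖k‖ ^ 2 := by ring

theorem tendsto_taylor {F : E → G} {x₀ : E} (hF : ContDiffAt ℝ 2 F x₀) (h : E) :
    Tendsto (fun p : (ℝ × E) × E => (2 / p.1.1 ^ 2) •
        (F (p.2 + p.1.1 • p.1.2) - F p.2 - p.1.1 • fderiv ℝ F p.2 p.1.2))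
      ((𝓝[>] (0 : ℝ) ×ˢ 𝓝 h) ×ˢ 𝓝 x₀) (𝓝 (fderiv ℝ (fderiv ℝ F) x₀ h h)) := by
  set D := fderiv ℝ (fderiv ℝ F) x₀ with hD
  have hh : Tendsto (fun p : (ℝ × E) × E => p.1.2) ((𝓝[>] (0 : ℝ) ×ˢ 𝓝 h) ×ˢ 𝓝 x₀) (𝓝 h) :=
    tendsto_snd.comp tendsto_fst
  have ht : Tendsto (fun p : (ℝ × E) × E => p.1.1) ((𝓝[>] (0 : ℝ) ×ˢ 𝓝 h) ×ˢ 𝓝 x₀)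
      (𝓝[>] (0 : ℝ)) := tendsto_fst.comp tendsto_fst
  have hx : Tendsto (fun p : (ℝ × E) × E => p.2) ((𝓝[>] (0 : ℝ) ×ˢ 𝓝 h) ×ˢ 𝓝 x₀) (𝓝 x₀) :=
    tendsto_snd
  have hDh : Tendsto (fun p : (ℝ × E) × E => D p.1.2 p.1.2) ((𝓝[>] (0 : ℝ) ×ˢ 𝓝 h) ×ˢ 𝓝 x₀)
      (𝓝 (D h h)) := tendsto_clm_apply ((D.continuous.tendsto h).comp hh) hh
  have hth : Tendsto (fun p : (ℝ × E) × E => p.1.1 • p.1.2) ((𝓝[>] (0 : ℝ) ×ˢ 𝓝 h) ×ˢ 𝓝 x₀)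
      (𝓝 0) := by
    simpa using (ht.mono_right nhdsWithin_le_nhds).smul hh
  suffices hzero : Tendsto (fun p : (ℝ × E) × E => (2 / p.1.1 ^ 2) •
        (F (p.2 + p.1.1 • p.1.2) - F p.2 - p.1.1 • fderiv ℝ F p.2 p.1.2) - D p.1.2 p.1.2)
      ((𝓝[>] (0 : ℝ) ×ˢ 𝓝 h) ×ˢ 𝓝 x₀) (𝓝 0) by
    simpa using hzero.add hDh
  rw [NormedAddGroup.tendsto_nhds_zero]
  intro ε hε
  have hc : 0 < 4 * (‖h‖ + 1) ^ 2 := by positivity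
  obtain ⟨δ, hδ, hb⟩ := exists_norm_taylor_le hF (div_pos hε hc)
  filter_upwards [hx (Metric.ball_mem_nhds _ hδ), hth (Metric.ball_mem_nhds _ hδ),
    hh.norm.eventually (gt_mem_nhds (lt_add_one ‖h‖)), ht self_mem_nhdsWithin]
    with ⟨⟨t, h'⟩, x⟩ h1 h2 h3 h4
  have h1 : ‖x - x₀‖ < δ := by rw [← dist_eq_norm]; exact h1
  have h2 : ‖t • h'‖ < δ := by rw [← dist_zero_right]; exact h2
  have h3 : ‖h'‖ < ‖h‖ + 1 := h3
  have h4 : 0 < t := h4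
  have h5 := hb x (t • h') h1 h2
  simp only
  have e : (2 / t ^ 2) • (F (x + t • h') - F x - t • fderiv ℝ F x h') - D h' h' =
      (2 / t ^ 2) • (F (x + t • h') - F x - fderiv ℝ F x (t • h') -
        (1 / 2 : ℝ) • D (t • h') (t • h')) := by
    rw [smul_sub _ _ ((1 / 2 : ℝ) • _)]
    simp only [map_smul, smul_apply, smul_smul]
    congr 1
    have : 2 / t ^ 2 * (1 / 2 * (t * t)) = 1 := by field_simp
    rw [this, one_smul]
  rw [e, norm_smul, Real.norm_of_nonneg (by positivity)]
  calc _ ≤ 2 / t ^ 2 * (ε / (4 * (‖h‖ + 1) ^ 2) * ‖t • h'‖ ^ 2) := by gcongr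
    _ = ε / 2 * (‖h'‖ / (‖h‖ + 1)) ^ 2 := by
      rw [norm_smul, Real.norm_of_nonneg h4.le]
      field_simp
      ring
    _ ≤ ε / 2 * 1 ^ 2 := by
      gcongr
      exact (div_le_one (by positivity)).2 h3.le
    _ < ε := by linarith

end Taylor

/-! ### Curves mapped into a subspace or a cone -/

section Curves

variable {E G : Type*} [NormedAddCommGroup E] [NormedSpace ℝ E] [CompleteSpace E]
  [NormedAddCommGroup G] [InnerProductSpace ℝ G] [FiniteDimensional ℝ G]

/-- If `F` is transversal to the subspace `V` at a point of `F⁻¹(V)`, then every `u` with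
`DF(x₀) u ∈ V` is the velocity of a curve in `F⁻¹(V)`. -/
theorem exists_curve_of_transversal {F : E → G} {L : E →L[ℝ] G} {x₀ : E}
    (hF : HasStrictFDerivAt F L x₀) (V : Submodule ℝ G) (h0 : F x₀ ∈ V)
    (hA : ∀ y : G, ∃ u : E, ∃ z ∈ V, y = L u - z) {u : E} (hu : L u ∈ V) :
    ∃ γ : ℝ → E, γ 0 = x₀ ∧ HasDerivAt γ u 0 ∧ ∀ᶠ t in 𝓝 (0 : ℝ), F (γ t) ∈ V := by
  -- `F⁻¹(V)` is the zero set of `P ∘ F`. Transversality makes `P ∘ L` surjective, so the implicit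
  -- function theorem applies.
  let P : G →L[ℝ] Vᗮ := Vᗮ.orthogonalProjectionOnto
  have hP : ∀ y, P y = 0 ↔ y ∈ V := fun y => by
    rw [Submodule.orthogonalProjectionOnto_eq_zero_iff, Submodule.orthogonal_orthogonal]
  have hf : HasStrictFDerivAt (fun x => P (F x)) (P.comp L) x₀ :=
    P.hasStrictFDerivAt.comp x₀ hF
  have hf' : (P.comp L).range = ⊤ := by
    rw [LinearMap.range_eq_top]
    intro y
    obtain ⟨w, z, hz, h⟩ := hA y
    refine ⟨w, ?_⟩
    have h1 : P (y : G) = y := Submodule.orthogonalProjectionOnto_mem_subspace_eq_self y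
    rw [← h1, h, map_sub, (hP z).2 hz, sub_zero]
    rfl
  have hker : u ∈ (P.comp L).ker := (hP _).2 hu
  let γ : ℝ → E := fun t =>
    hf.implicitFunction (fun x => P (F x)) (P.comp L) hf' (P (F x₀)) (t • ⟨u, hker⟩)
  have hlin : HasDerivAt (fun t : ℝ => t • (⟨u, hker⟩ : (P.comp L).ker)) ⟨u, hker⟩ 0 := by
    have := (hasDerivAt_id (0 : ℝ)).smul_const (⟨u, hker⟩ : (P.comp L).ker)
    rwa [one_smul] at this
  refine ⟨γ, ?_, ?_, ?_⟩
  · simp only [γ, zero_smul]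
    exact hf.implicitFunction_apply_image hf'
  · have h1 := (hf.to_implicitFunction hf').hasFDerivAt
    rw [← zero_smul ℝ (⟨u, hker⟩ : (P.comp L).ker)] at h1
    exact h1.comp_hasDerivAt 0 hlin
  · have h1 := hf.map_implicitFunction_eq hf'
    have h2 : Tendsto (fun t : ℝ => (P (F x₀), t • (⟨u, hker⟩ : (P.comp L).ker))) (𝓝 0)
        (𝓝 (P (F x₀), 0)) := by
      have := hlin.continuousAt.tendsto
      rw [zero_smul] at this
      exact tendsto_const_nhds.prodMk_nhds this
    filter_upwards [h2.eventually h1] with t ht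
    rw [← hP]
    exact ht.trans ((hP _).2 h0)

/-- Along a curve in `F⁻¹(V)` with velocity `u`, `t⁻¹ • F (γ t)` tends to `L u` inside `V`, hence
enters `K`; scaling back by `t` stays in the cone. -/
theorem exists_curve_in_cone {F : E → G} {L : E →L[ℝ] G} {x₀ : E}
    (hF : HasStrictFDerivAt F L x₀) (h0 : F x₀ = 0) {K : Set G}
    (hK : ∀ t : ℝ, 0 ≤ t → ∀ z ∈ K, t • z ∈ K) (V : Submodule ℝ G)
    (hA : ∀ y : G, ∃ u : E, ∃ z ∈ V, y = L u - z) {u : E} (hu : L u ∈ V)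
    (hint : K ∈ 𝓝[V] (L u)) :
    ∃ γ : ℝ → E, γ 0 = x₀ ∧ HasDerivAt γ u 0 ∧ ∀ᶠ t in 𝓝[>] (0 : ℝ), F (γ t) ∈ K := by
  obtain ⟨γ, hγ0, hγ, hV⟩ := exists_curve_of_transversal hF V (h0 ▸ V.zero_mem) hA hu
  refine ⟨γ, hγ0, hγ, ?_⟩
  have h1 : HasDerivAt (fun t => F (γ t)) (L u) 0 := by
    rw [← hγ0] at hF
    exact hF.hasFDerivAt.comp_hasDerivAt 0 hγ
  have h2 := h1.tendsto_slope_zero_right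
  simp only [zero_add, hγ0, h0, sub_zero] at h2
  have h3 : Tendsto (fun t => t⁻¹ • F (γ t)) (𝓝[>] (0 : ℝ)) (𝓝[V] (L u)) :=
    tendsto_nhdsWithin_iff.2 ⟨h2, (hV.filter_mono nhdsWithin_le_nhds).mono
      fun t ht => V.smul_mem _ ht⟩
  filter_upwards [h3 hint, self_mem_nhdsWithin] with t ht ht0
  have := hK t (le_of_lt ht0) _ ht
  rwa [smul_smul, mul_inv_cancel₀ (ne_of_gt ht0), one_smul] at this

end Curves

/-! ### Relative interiors of convex cones -/

section RelativeInterior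

variable {G : Type*} [NormedAddCommGroup G] [NormedSpace ℝ G]

theorem exists_mem_nhdsWithin_span [FiniteDimensional ℝ G] {K : Set G} (hK : Convex ℝ K) (h0 : (0 : G) ∈ K) :
    ∃ z ∈ K, K ∈ 𝓝[Submodule.span ℝ K] z := by
  let V := Submodule.span ℝ K
  let K' : Set V := (↑) ⁻¹' K
  have hconv : Convex ℝ K' := hK.is_linear_preimage V.subtype.isLinear
  have h0' : (0 : V) ∈ K' := h0
  have hspan : affineSpan ℝ K' = ⊤ := by
    rw [AffineSubspace.affineSpan_eq_top_iff_vectorSpan_eq_top_of_nonempty ℝ V V ⟨0, h0'⟩,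
      eq_top_iff, ← Submodule.span_span_coe_preimage, Submodule.span_le]
    intro x hx
    simpa using vsub_mem_vectorSpan ℝ hx h0'
  obtain ⟨z, hz⟩ := hconv.interior_nonempty_iff_affineSpan_eq_top.2 hspan
  refine ⟨z, interior_subset (s := K') hz, ?_⟩
  rw [nhdsWithin_eq_map_subtype_coe z.2]
  exact mem_interior_iff_mem_nhds.1 hz

theorem mem_nhdsWithin_submodule_add {K : Set G} {V : Submodule ℝ G}
    (hadd : ∀ a ∈ K, ∀ b ∈ K, a + b ∈ K) {z w : G} (hw : w ∈ K) (hwV : w ∈ V)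
    (hz : K ∈ 𝓝[V] z) : K ∈ 𝓝[V] (z + w) := by
  have h : Tendsto (fun y => y - w) (𝓝[V] (z + w)) (𝓝[V] z) := by
    refine tendsto_nhdsWithin_iff.2 ⟨?_, ?_⟩
    · have : Tendsto (fun y => y - w) (𝓝 (z + w)) (𝓝 (z + w - w)) :=
        (continuous_id.sub continuous_const).tendsto _
      rw [add_sub_cancel_right] at this
      exact this.mono_left nhdsWithin_le_nhds
    · filter_upwards [self_mem_nhdsWithin] with y hy
      exact V.sub_mem hy hwV
  filter_upwards [h hz] with y hy
  simpa using hadd _ hy _ hw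

variable {E : Type*} [NormedAddCommGroup E] [NormedSpace ℝ E]

/-- If `A` is transversal to the cone `K` and `A h ∈ span K`, then `w` and `w + ε h` are, for some
`w` and some `ε > 0`, mapped to the relative interior of `K`. -/
theorem exists_mem_nhdsWithin_span_pair [FiniteDimensional ℝ G] {K : Set G} (hK : Convex ℝ K) (h0 : (0 : G) ∈ K)
    (hadd : ∀ a ∈ K, ∀ b ∈ K, a + b ∈ K) (A : E →L[ℝ] G)
    (hA : {y : G | ∃ u : E, ∃ z ∈ K, y = A u - z} = univ) {h : E}
    (hh : A h ∈ Submodule.span ℝ K) :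
    ∃ w : E, ∃ ε : ℝ, 0 < ε ∧ A w ∈ K ∧ A (w + ε • h) ∈ K ∧ K ∈ 𝓝[Submodule.span ℝ K] (A w) ∧
      K ∈ 𝓝[Submodule.span ℝ K] (A (w + ε • h)) := by
  obtain ⟨z, hzK, hz⟩ := exists_mem_nhdsWithin_span hK h0
  -- Transversality at a relative interior point `z` gives `A w = z + z'` with `z' ∈ K`, again a
  -- relative interior point.
  obtain ⟨w, z', hz', e⟩ : z ∈ {y : G | ∃ u : E, ∃ z ∈ K, y = A u - z} := hA ▸ mem_univ _
  have e : A w = z + z' := by rw [e, sub_add_cancel]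
  have hw : K ∈ 𝓝[Submodule.span ℝ K] (A w) :=
    e ▸ mem_nhdsWithin_submodule_add hadd hz' (Submodule.subset_span hz') hz
  have hwK : A w ∈ K := e ▸ hadd _ hzK _ hz'
  have hlim : Tendsto (fun ε : ℝ => A (w + ε • h)) (𝓝[>] 0) (𝓝[Submodule.span ℝ K] (A w)) := by
    refine tendsto_nhdsWithin_iff.2 ⟨?_, Eventually.of_forall fun ε => ?_⟩
    · have : Continuous fun ε : ℝ => A (w + ε • h) := by fun_prop
      simpa using (this.tendsto 0).mono_left nhdsWithin_le_nhds
    · rw [map_add, map_smul]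
      exact Submodule.add_mem _ (Submodule.subset_span hwK) (Submodule.smul_mem _ _ hh)
  obtain ⟨ε, ⟨h1, h2⟩, h3⟩ := ((hlim.eventually
    ((eventually_mem_set.2 hw).and (eventually_eventually_nhdsWithin.2 hw))).and
      self_mem_nhdsWithin).exists
  exact ⟨w, ε, h3, hwK, h1, hw, h2⟩

end RelativeInterior

/-! ### Second-order quotients and the filter of the strict subderivative -/

section Quotient

variable {E : Type*} [NormedAddCommGroup E] [InnerProductSpace ℝ E]

theorem le_secondQuotient {φ : E → EReal} {t : ℝ} {x v h : E} {a b : ℝ}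
    (ha : (a : EReal) ≤ φ (x + t • h)) (hb : φ x = b) :
    ((2 / t ^ 2 * (a - b - t * inner ℝ v h) : ℝ) : EReal) ≤ secondQuotient φ t x v h := by
  have h1 : ((2 / t ^ 2 * (a - b - t * inner ℝ v h) : ℝ) : EReal) =
      ((a : EReal) - b - ((t * inner ℝ v h : ℝ) : EReal)) / ((t ^ 2 / 2 : ℝ) : EReal) := by
    rw [← EReal.coe_sub, ← EReal.coe_sub, ← EReal.coe_div, EReal.coe_eq_coe_iff]
    ring
  rw [h1, secondQuotient, hb]
  refine EReal.div_le_div_right_of_nonneg (by exact_mod_cast (by positivity)) ?_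
  exact EReal.sub_le_sub (EReal.sub_le_sub ha le_rfl) le_rfl

theorem secondQuotient_eq {φ : E → EReal} {t : ℝ} {x v h : E} {a b : ℝ}
    (ha : φ (x + t • h) = a) (hb : φ x = b) :
    secondQuotient φ t x v h = ((2 / t ^ 2 * (a - b - t * inner ℝ v h) : ℝ) : EReal) := by
  rw [secondQuotient, ha, hb, ← EReal.coe_sub, ← EReal.coe_sub, ← EReal.coe_div,
    EReal.coe_eq_coe_iff]
  ring

theorem regularSubdiff_subset_subdiff (φ : E → EReal) (x : E) :
    regularSubdiff φ x ⊆ subdiff φ x := by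
  refine fun v hv => ⟨hv.1, hv.2.1, fun ε hε => ?_⟩
  rw [frequently_iff]
  intro s hs
  refine ⟨x, ?_, v, hv, by simpa using hε⟩
  have hle : pure x ≤ 𝓝 x ⊓ comap φ (𝓝 (φ x)) :=
    le_inf (pure_le_nhds x) (map_le_iff_le_comap.1 (by rw [map_pure]; exact pure_le_nhds _))
  exact mem_pure.1 (hle hs)

/-- The filter along which the lower limit `strictSecondSubderiv φ x₀ v₀ h` is taken. -/
noncomputable def strictFilter (φ : E → EReal) (x₀ v₀ h : E) : Filter ((ℝ × E) × (E × E)) :=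
  (𝓝[>] (0 : ℝ) ×ˢ 𝓝 h) ×ˢ (𝓝[{q : E × E | q.2 ∈ subdiff φ q.1}] (x₀, v₀) ⊓
    comap (fun q : E × E => φ q.1) (𝓝 (φ x₀)))

theorem tendsto_strictFilter_graph (φ : E → EReal) (x₀ v₀ h : E) :
    Tendsto Prod.snd (strictFilter φ x₀ v₀ h) (𝓝[{q : E × E | q.2 ∈ subdiff φ q.1}] (x₀, v₀)) :=
  tendsto_snd.mono_right inf_le_left

theorem tendsto_strictFilter_point (φ : E → EReal) (x₀ v₀ h : E) :
    Tendsto (fun p : (ℝ × E) × (E × E) => p.2.1) (strictFilter φ x₀ v₀ h) (𝓝 x₀) :=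
  ((continuous_fst.tendsto (x₀, v₀)).mono_left nhdsWithin_le_nhds).comp
    (tendsto_strictFilter_graph φ x₀ v₀ h)

theorem tendsto_strictFilter_time (φ : E → EReal) (x₀ v₀ h : E) :
    Tendsto (fun p : (ℝ × E) × (E × E) => p.1.1) (strictFilter φ x₀ v₀ h) (𝓝[>] (0 : ℝ)) :=
  tendsto_fst.comp (tendsto_fst (f := 𝓝[>] (0 : ℝ) ×ˢ 𝓝 h))

theorem tendsto_strictFilter_direction (φ : E → EReal) (x₀ v₀ h : E) :
    Tendsto (fun p : (ℝ × E) × (E × E) => p.1.2) (strictFilter φ x₀ v₀ h) (𝓝 h) :=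
  tendsto_snd.comp (tendsto_fst (f := 𝓝[>] (0 : ℝ) ×ˢ 𝓝 h))

theorem tendsto_strictFilter_base (φ : E → EReal) (x₀ v₀ h : E) :
    Tendsto (fun p : (ℝ × E) × (E × E) => (p.1, p.2.1)) (strictFilter φ x₀ v₀ h)
      ((𝓝[>] (0 : ℝ) ×ˢ 𝓝 h) ×ˢ 𝓝 x₀) :=
  tendsto_fst.prodMk (tendsto_strictFilter_point φ x₀ v₀ h)

theorem tendsto_strictFilter_shift (φ : E → EReal) (x₀ v₀ h : E) :
    Tendsto (fun p : (ℝ × E) × (E × E) => p.2.1 + p.1.1 • p.1.2) (strictFilter φ x₀ v₀ h)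
      (𝓝 x₀) := by
  simpa using (tendsto_strictFilter_point φ x₀ v₀ h).add
    (((tendsto_strictFilter_time φ x₀ v₀ h).mono_right nhdsWithin_le_nhds).smul
      (tendsto_strictFilter_direction φ x₀ v₀ h))

end Quotient

/-! ### Multipliers along the graph of the subdifferential -/

section Composite

variable {E G : Type*} [NormedAddCommGroup E] [InnerProductSpace ℝ E] [CompleteSpace E]
  [NormedAddCommGroup G] [InnerProductSpace ℝ G] [CompleteSpace G]

/-- Near `x`, the differentiable function `r + ⟨lam, F ·⟩` is a minorant of `φ`, with equality at
`x` because `F x` is normal to `Q` at `lam`. -/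
theorem adjoint_mem_regularSubdiff {Q : Set G} (hQ : Convex ℝ Q) {φ : E → EReal} {r : ℝ}
    {F : E → G} {U : Set E} (hU : IsOpen U) (hF : DifferentiableOn ℝ F U)
    (hφ : ∀ x ∈ U, φ x = (r : EReal) + supportFun Q (F x)) {x : E} (hx : x ∈ U) {lam : G}
    (hlam : lam ∈ Q) (hn : F x ∈ normalCone Q lam) :
    (fderiv ℝ F x).adjoint lam ∈ regularSubdiff φ x := by
  have hx' : φ x = ((r + inner ℝ lam (F x) : ℝ) : EReal) := by
    rw [hφ x hx, supportFun_eq_of_mem_normalCone hQ hlam hn, EReal.coe_add]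
  refine ⟨hx' ▸ EReal.coe_ne_top _, hx' ▸ EReal.coe_ne_bot _, fun ε hε => ?_⟩
  have hd := (hF.differentiableAt (hU.mem_nhds hx)).hasFDerivAt
  have hd' := ((innerSL ℝ lam).hasFDerivAt.comp x hd).isLittleO.def hε
  filter_upwards [hd', hU.mem_nhds hx] with y hy hyU
  rw [hx', hφ y hyU]
  refine le_trans ?_ (add_le_add_right (le_supportFun hlam (F y)) _)
  rw [← EReal.coe_add, ← EReal.coe_add, EReal.coe_le_coe_iff,
    ContinuousLinearMap.adjoint_inner_left]
  rw [Real.norm_eq_abs, abs_le] at hy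
  simp only [Function.comp_apply, innerSL_apply_apply, ContinuousLinearMap.comp_apply] at hy
  linarith [hy.1]

/-- A continuous selection of multipliers at `(x₀, DF(x₀)ᵀ lam₀)` along the graph of `∂φ`. -/
theorem exists_tendsto_multiplier [FiniteDimensional ℝ E] [FiniteDimensional ℝ G] {Q : Set G}
    (hcl : IsClosed Q) (hQ : Convex ℝ Q) {lam₀ : G} (hl : lam₀ ∈ Q) {φ : E → EReal} {r : ℝ}
    {F : E → G} {U : Set E} (hU : IsOpen U) (hF : ContDiffOn ℝ 2 F U)
    (hφ : ∀ x ∈ U, φ x = (r : EReal) + supportFun Q (F x)) {x₀ : E} (hx₀ : x₀ ∈ U)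
    (hA : {y : G | ∃ u : E, ∃ z ∈ normalCone Q lam₀, y = fderiv ℝ F x₀ u - z} = univ) :
    ∃ Λ : E × E → G,
      Tendsto Λ (𝓝[{q : E × E | q.2 ∈ subdiff φ q.1}] (x₀, (fderiv ℝ F x₀).adjoint lam₀))
        (𝓝[Q] lam₀) ∧
      ∀ᶠ q in 𝓝[{q : E × E | q.2 ∈ subdiff φ q.1}] (x₀, (fderiv ℝ F x₀).adjoint lam₀),
        Λ q ∈ Q ∧ q.2 = (fderiv ℝ F q.1).adjoint (Λ q) ∧ F q.1 ∈ normalCone Q (Λ q) := by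
  have h := eventually_nhdsWithin_iff.2
    (eventually_exists_multiplier hcl hQ hl hU hF hφ hx₀ hA)
  choose! Λ hsel using fun (q : E × E) (hq : ∃ lam ∈ Q, q.2 = (fderiv ℝ F q.1).adjoint lam ∧
    F q.1 ∈ normalCone Q lam) => hq
  have hΛ := h.mono hsel
  refine ⟨Λ, tendsto_nhdsWithin_iff.2 ⟨?_, hΛ.mono fun q hq => hq.1⟩, hΛ⟩
  rw [Metric.tendsto_nhds]
  intro ε hε
  obtain ⟨δ, hδ, hclose⟩ := exists_multiplier_close hQ hl _ hA hε
  have hDc : ContinuousAt (fderiv ℝ F) x₀ :=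
    ((hF.contDiffAt (hU.mem_nhds hx₀)).fderiv_right (m := 1) (by norm_num)).continuousAt
  have h1 : ∀ᶠ q : E × E in 𝓝 (x₀, (fderiv ℝ F x₀).adjoint lam₀),
      ‖fderiv ℝ F q.1 - fderiv ℝ F x₀‖ < δ := by
    have h2 : ContinuousAt (fun q : E × E => fderiv ℝ F q.1)
        (x₀, (fderiv ℝ F x₀).adjoint lam₀) :=
      ContinuousAt.comp (f := Prod.fst) hDc continuousAt_fst
    filter_upwards [h2.eventually (Metric.ball_mem_nhds _ hδ)] with q hq
    rwa [← dist_eq_norm]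
  have h3 : ∀ᶠ q : E × E in 𝓝 (x₀, (fderiv ℝ F x₀).adjoint lam₀),
      ‖q.2 - (fderiv ℝ F x₀).adjoint lam₀‖ < δ := by
    filter_upwards [continuousAt_snd.eventually (Metric.ball_mem_nhds _ hδ)] with q hq
    rwa [← dist_eq_norm]
  filter_upwards [hΛ, h1.filter_mono nhdsWithin_le_nhds, h3.filter_mono nhdsWithin_le_nhds]
    with q hq hq1 hq2
  rw [dist_eq_norm]
  exact hclose _ hq1 _ hq.1 (hq.2.1 ▸ hq2)

/-- Multipliers along the graph of `∂φ`, together with the lower estimates of the second-order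
difference quotients given by the elements of `Q`. -/
theorem exists_multiplier_le_secondQuotient [FiniteDimensional ℝ E] [FiniteDimensional ℝ G]
    {Q : Set G} (hcl : IsClosed Q) (hQ : Convex ℝ Q) {lam₀ : G} (hl : lam₀ ∈ Q) {φ : E → EReal}
    {r : ℝ} {F : E → G} {U : Set E} (hU : IsOpen U) (hF : ContDiffOn ℝ 2 F U)
    (hφ : ∀ x ∈ U, φ x = (r : EReal) + supportFun Q (F x)) {x₀ : E} (hx₀ : x₀ ∈ U)
    (hA : {y : G | ∃ u : E, ∃ z ∈ normalCone Q lam₀, y = fderiv ℝ F x₀ u - z} = univ) (h : E) :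
    ∃ Λ : (ℝ × E) × (E × E) → G,
      Tendsto Λ (strictFilter φ x₀ ((fderiv ℝ F x₀).adjoint lam₀) h) (𝓝[Q] lam₀) ∧
      ∀ᶠ p in strictFilter φ x₀ ((fderiv ℝ F x₀).adjoint lam₀) h,
        0 < p.1.1 ∧ Λ p ∈ Q ∧ F p.2.1 ∈ normalCone Q (Λ p) ∧
        ∀ q ∈ Q, ((inner ℝ (Λ p) ((2 / p.1.1 ^ 2) •
            (F (p.2.1 + p.1.1 • p.1.2) - F p.2.1 - p.1.1 • fderiv ℝ F p.2.1 p.1.2)) +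
            2 / p.1.1 ^ 2 * inner ℝ (q - Λ p) (F (p.2.1 + p.1.1 • p.1.2)) : ℝ) : EReal) ≤
          secondQuotient φ p.1.1 p.2.1 p.2.2 p.1.2 := by
  obtain ⟨Λ, hΛt, hΛ⟩ := exists_tendsto_multiplier hcl hQ hl hU hF hφ hx₀ hA
  have hg := tendsto_strictFilter_graph φ x₀ ((fderiv ℝ F x₀).adjoint lam₀) h
  have ht := tendsto_strictFilter_time φ x₀ ((fderiv ℝ F x₀).adjoint lam₀) h
  have hx := tendsto_strictFilter_point φ x₀ ((fderiv ℝ F x₀).adjoint lam₀) h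
  have hxt := tendsto_strictFilter_shift φ x₀ ((fderiv ℝ F x₀).adjoint lam₀) h
  refine ⟨fun p => Λ p.2, hΛt.comp hg, ?_⟩
  filter_upwards [hg.eventually hΛ, ht self_mem_nhdsWithin, hx.eventually (hU.eventually_mem hx₀),
    hxt.eventually (hU.eventually_mem hx₀)] with ⟨⟨t, h'⟩, ⟨x, v⟩⟩ ⟨h1, h2, h3⟩ h4 h5 h6
  simp only at h1 h2 h3 h5 h6 ⊢
  refine ⟨h4, h1, h3, fun q hq => ?_⟩
  have hxv : φ x = ((r + inner ℝ (Λ (x, v)) (F x) : ℝ) : EReal) := by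
    rw [hφ x h5, supportFun_eq_of_mem_normalCone hQ h1 h3, EReal.coe_add]
  have hqv : ((r + inner ℝ q (F (x + t • h')) : ℝ) : EReal) ≤ φ (x + t • h') := by
    rw [hφ _ h6, EReal.coe_add]
    exact add_le_add_right (le_supportFun hq _) _
  refine le_trans (le_of_eq ?_) (le_secondQuotient hqv hxv)
  rw [EReal.coe_eq_coe_iff, real_inner_smul_right, h2, ContinuousLinearMap.adjoint_inner_left,
    inner_sub_right, inner_sub_right, inner_smul_right, inner_sub_left, ← h2]
  ring

end Composite

/-! ### First-order quotients and the affine hull of the preimage cone -/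

section Preliminaries

variable {E G : Type*} [NormedAddCommGroup E] [InnerProductSpace ℝ E]
  [NormedAddCommGroup G] [InnerProductSpace ℝ G]

theorem tendsto_difference_quotient {φ : E → EReal} {F : E → G} {U : Set E}
    {x₀ : E} (hU : IsOpen U) (hF : ContDiffOn ℝ 2 F U) (hx₀ : x₀ ∈ U)
    (v₀ h : E) :
    Tendsto (fun p : (ℝ × E) × (E × E) => p.1.1⁻¹ • (F (p.2.1 + p.1.1 • p.1.2) - F p.2.1))
      (strictFilter φ x₀ v₀ h) (𝓝 (fderiv ℝ F x₀ h)) := by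
  have hd := (hF.contDiffAt (hU.mem_nhds hx₀)).hasStrictFDerivAt (by norm_num)
  have ht := tendsto_strictFilter_time φ x₀ v₀ h
  have hT := (tendsto_taylor (hF.contDiffAt (hU.mem_nhds hx₀)) h).comp
    (tendsto_strictFilter_base φ x₀ v₀ h)
  have hDc : ContinuousAt (fderiv ℝ F) x₀ :=
    ((hF.contDiffAt (hU.mem_nhds hx₀)).fderiv_right (m := 1) (by norm_num)).continuousAt
  have hD := tendsto_clm_apply (hDc.tendsto.comp (tendsto_strictFilter_point φ x₀ v₀ h))
    (tendsto_strictFilter_direction φ x₀ v₀ h)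
  have hsum := hD.add (((ht.mono_right nhdsWithin_le_nhds).div_const 2).smul hT)
  rw [zero_div, zero_smul, add_zero] at hsum
  refine hsum.congr' ?_
  filter_upwards [ht self_mem_nhdsWithin] with p hp
  have hp : p.1.1 ≠ 0 := ne_of_gt hp
  simp only [Function.comp_apply]
  rw [smul_smul, smul_sub _ (_ - _) (p.1.1 • _), smul_smul]
  have e1 : p.1.1 / 2 * (2 / p.1.1 ^ 2) = p.1.1⁻¹ := by field_simp
  rw [e1, inv_mul_cancel₀ hp, one_smul]
  abel

/-- The preimage contains `0`, so its affine hull is linear. If `A h ∈ span K`, then `h` is a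
multiple of the difference of the two points `w + ε h` and `w` of the preimage. -/
theorem mem_affineSpan_preimage_iff [FiniteDimensional ℝ G] (A : E →L[ℝ] G) {K : Set G}
    (hK : Convex ℝ K)
    (h0 : (0 : G) ∈ K) (hadd : ∀ a ∈ K, ∀ b ∈ K, a + b ∈ K)
    (hA : {y : G | ∃ u : E, ∃ z ∈ K, y = A u - z} = univ) (h : E) :
    h ∈ affineSpan ℝ (A ⁻¹' K) ↔ A h ∈ Submodule.span ℝ K := by
  constructor
  · have hle : affineSpan ℝ (A ⁻¹' K) ≤
        ((Submodule.span ℝ K).comap (A : E →ₗ[ℝ] G)).toAffineSubspace :=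
      affineSpan_le.2 fun u hu => Submodule.subset_span hu
    exact fun hh => hle hh
  · intro hh
    obtain ⟨w, ε, hε, hwK, hwhK, -, -⟩ := exists_mem_nhdsWithin_span_pair hK h0 hadd A hA hh
    have h1 : w ∈ affineSpan ℝ (A ⁻¹' K) := subset_affineSpan ℝ _ hwK
    have h2 : w + ε • h ∈ affineSpan ℝ (A ⁻¹' K) := subset_affineSpan ℝ _ hwhK
    have h3 : (0 : E) ∈ affineSpan ℝ (A ⁻¹' K) :=
      subset_affineSpan ℝ _ (by rw [mem_preimage, map_zero]; exact h0)
    have h4 := AffineSubspace.smul_vsub_vadd_mem _ ε⁻¹ h2 h1 h3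
    rwa [vsub_eq_sub, add_sub_cancel_left, smul_smul, inv_mul_cancel₀ hε.ne', one_smul,
      vadd_eq_add, add_zero] at h4

end Preliminaries

/-! ### The lower bound, the infinite value and the upper bound -/

section Bounds

variable {E G : Type*} [NormedAddCommGroup E] [InnerProductSpace ℝ E]
  [CompleteSpace E] [NormedAddCommGroup G] [InnerProductSpace ℝ G] [FiniteDimensional ℝ G]
  [CompleteSpace G]
  {Q : Set G} {lam₀ : G} {φ : E → EReal} {r : ℝ} {F : E → G} {U : Set E} {x₀ : E}

theorem le_strictSecondSubderiv [FiniteDimensional ℝ E] (hcl : IsClosed Q) (hQ : Convex ℝ Q)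
    (hl : lam₀ ∈ Q)
    (hU : IsOpen U) (hF : ContDiffOn ℝ 2 F U)
    (hφ : ∀ x ∈ U, φ x = (r : EReal) + supportFun Q (F x)) (hx₀ : x₀ ∈ U)
    (hA : {y : G | ∃ u : E, ∃ z ∈ normalCone Q lam₀, y = fderiv ℝ F x₀ u - z} = univ) (h : E) :
    ((inner ℝ lam₀ (fderiv ℝ (fderiv ℝ F) x₀ h h) : ℝ) : EReal) ≤
      strictSecondSubderiv φ x₀ ((fderiv ℝ F x₀).adjoint lam₀) h := by
  obtain ⟨Λ, hΛt, hΛ⟩ := exists_multiplier_le_secondQuotient hcl hQ hl hU hF hφ hx₀ hA h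
  have hT := (tendsto_taylor (hF.contDiffAt (hU.mem_nhds hx₀)) h).comp
    (tendsto_strictFilter_base φ x₀ ((fderiv ℝ F x₀).adjoint lam₀) h)
  have hlim := (tendsto_nhdsWithin_iff.1 hΛt).1.inner (𝕜 := ℝ) hT
  refine EReal.ge_of_forall_gt_iff_ge.1 fun c hc => le_liminf_of_le (by isBoundedDefault) ?_
  filter_upwards [hlim.eventually (lt_mem_nhds (EReal.coe_lt_coe_iff.1 hc)), hΛ]
    with p hp ⟨_, h2, _, h4⟩
  refine le_trans ?_ (h4 _ h2)
  rw [sub_self, inner_zero_left, mul_zero, add_zero, EReal.coe_le_coe_iff]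
  exact hp.le

/-- The quotient is tested with a point of `Q` on a tangent path from the multiplier, at distance of
order `t`. Its first-order displacement is orthogonal to `F x`, so it only sees `F (x + t h') - F x
≈ t DF(x₀) h`; its second-order error is paired with `F (x + t h') → 0`. -/
theorem strictSecondSubderiv_eq_top [FiniteDimensional ℝ E] (hcl : IsClosed Q) (hQ : Convex ℝ Q)
    (hl : lam₀ ∈ Q)
    (hU : IsOpen U) (hF : ContDiffOn ℝ 2 F U)
    (hφ : ∀ x ∈ U, φ x = (r : EReal) + supportFun Q (F x)) (hx₀ : x₀ ∈ U) (h0 : F x₀ = 0)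
    (hA : {y : G | ∃ u : E, ∃ z ∈ normalCone Q lam₀, y = fderiv ℝ F x₀ u - z} = univ)
    (husotp : HasUSOTP Q lam₀) {h : E}
    (hh : fderiv ℝ F x₀ h ∉ Submodule.span ℝ (normalCone Q lam₀)) :
    strictSecondSubderiv φ x₀ ((fderiv ℝ F x₀).adjoint lam₀) h = ⊤ := by
  set K := normalCone Q lam₀ with hK
  set L := fderiv ℝ F x₀ with hL
  obtain ⟨w, hw, hwL⟩ : ∃ w ∈ (Submodule.span ℝ K)ᗮ, inner ℝ w (L h) = 1 := by
    by_contra! hcon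
    refine hh ?_
    rw [← Submodule.orthogonal_orthogonal (Submodule.span ℝ K), Submodule.mem_orthogonal]
    intro w hw
    by_contra hne
    refine hcon ((inner ℝ w (L h))⁻¹ • w) (Submodule.smul_mem _ _ hw) ?_
    rw [real_inner_smul_left, inv_mul_cancel₀ hne]
  obtain ⟨δ, hδ, M, hM, V, hV, S, hS, hSconv, hpath⟩ := husotp
  have hwlin := mem_lineality_of_mem_orthogonal hQ hl hw
  rw [← hSconv.2] at hwlin
  -- The inner limit only provides some nearby element of `S lam`; the projection is at least as
  -- near and needs no choice.
  have hproj : Tendsto (fun lam => (S lam).starProjection w) (𝓝[Q] lam₀) (𝓝 w) := by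
    rw [Metric.tendsto_nhds]
    intro ε hε
    filter_upwards [hwlin ε hε] with lam ⟨y, hy, hyw⟩
    rw [dist_comm, dist_eq_norm, Submodule.starProjection_minimal]
    refine lt_of_le_of_lt (ciInf_le ⟨0, ?_⟩ (⟨y, hy⟩ : S lam)) (by rwa [norm_sub_rev])
    rintro _ ⟨z, rfl⟩
    exact norm_nonneg _
  obtain ⟨Λ, hΛt, hΛ⟩ := exists_multiplier_le_secondQuotient hcl hQ hl hU hF hφ hx₀ hA h
  let W : (ℝ × E) × (E × E) → G := fun p => (S (Λ p)).starProjection w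
  have hW : Tendsto W (strictFilter φ x₀ (L.adjoint lam₀) h) (𝓝 w) := hproj.comp hΛt
  have hw0 : w ≠ 0 := by
    rintro rfl
    simp at hwL
  have ht := tendsto_strictFilter_time φ x₀ (L.adjoint lam₀) h
  have ht0 := ht.mono_right nhdsWithin_le_nhds
  have hT := (tendsto_taylor (hF.contDiffAt (hU.mem_nhds hx₀)) h).comp
    (tendsto_strictFilter_base φ x₀ (L.adjoint lam₀) h)
  have hdq := tendsto_difference_quotient (φ := φ) hU hF hx₀ (L.adjoint lam₀) h
  have hFt : Tendsto (fun p : (ℝ × E) × (E × E) => F (p.2.1 + p.1.1 • p.1.2))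
      (strictFilter φ x₀ (L.adjoint lam₀) h) (𝓝 0) := by
    rw [← h0]
    exact (hF.continuousOn.continuousAt (hU.mem_nhds hx₀)).tendsto.comp
      (tendsto_strictFilter_shift φ x₀ (L.adjoint lam₀) h)
  rw [eq_top_iff]
  refine EReal.ge_of_forall_gt_iff_ge.1 fun c _ => le_liminf_of_le (by isBoundedDefault) ?_
  set d := inner ℝ lam₀ (fderiv ℝ (fderiv ℝ F) x₀ h h) with hd
  -- `2 * A` is the limiting gain in the quotient over the finite value `d`.
  obtain ⟨A, hA0, hAc⟩ : ∃ A : ℝ, 0 < A ∧ c < d + 2 * A :=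
    ⟨|c - d| + 1, by positivity, by linarith [le_abs_self (c - d), abs_nonneg (c - d)]⟩
  have hlim := (((tendsto_nhdsWithin_iff.1 hΛt).1.inner (𝕜 := ℝ) hT).add
    ((hW.inner (𝕜 := ℝ) hdq).const_mul (2 * A))).sub
      ((((hW.norm.pow 2).const_mul (A ^ 2)).mul_const M).mul hFt.norm)
  rw [norm_zero, mul_zero, sub_zero, hwL, mul_one] at hlim
  have hsmall : Tendsto (fun p => A * p.1.1 * ‖W p‖) (strictFilter φ x₀ (L.adjoint lam₀) h)
      (𝓝 0) := by
    simpa using (ht0.const_mul A).mul hW.norm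
  have hΛV : ∀ᶠ p in strictFilter φ x₀ (L.adjoint lam₀) h, Λ p ∈ V :=
    (hΛt.mono_right nhdsWithin_le_nhds).eventually (eventually_mem_set.2 hV)
  filter_upwards [hlim.eventually (lt_mem_nhds hAc), hΛ, hΛV, hsmall.eventually (gt_mem_nhds hδ),
    hW.eventually_ne hw0] with p hp ⟨hpt, hpQ, hpN, hple⟩ hpV hps hpW
  have hWS : W p ∈ S (Λ p) := Submodule.starProjection_apply_mem _ _
  have hWn : 0 < ‖W p‖ := norm_pos_iff.2 hpW
  -- Path parameter for which the unit direction `W p / ‖W p‖` yields the displacement `A t • W p`.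
  set s := A * p.1.1 * ‖W p‖ with hs
  have hs0 : 0 ≤ s := by positivity
  obtain ⟨ξ, ρ, hξ⟩ := hpath (Λ p) ⟨hpQ, hpV⟩ (‖W p‖⁻¹ • W p) (Submodule.smul_mem _ _ hWS)
    (norm_smul_inv_norm hpW)
  obtain ⟨hξQ, hξe, hρ⟩ := hξ s ⟨hs0, hps.le⟩
  refine le_trans ?_ (hple _ hξQ)
  rw [EReal.coe_le_coe_iff]
  refine hp.le.trans ?_
  -- Both `W p` and `-W p` are tangent at the multiplier, while `F x` is normal there.
  have horth : inner ℝ (W p) (F p.2.1) = 0 := by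
    have h1 := hS (Λ p) ⟨hpQ, hpV⟩ hWS
    have h2 := hpN _ h1.1
    have h3 := hpN _ h1.2
    rw [inner_neg_right] at h3
    rw [real_inner_comm]
    linarith
  have hξsub : ξ s - Λ p = (A * p.1.1) • W p + (A ^ 2 * p.1.1 ^ 2 * ‖W p‖ ^ 2 / 2) • ρ s := by
    rw [hξe, add_assoc, add_sub_cancel_left, smul_smul]
    congr 2
    · rw [hs]; field_simp
    · rw [hs]; ring
  have hρF : -(M * ‖F (p.2.1 + p.1.1 • p.1.2)‖) ≤ inner ℝ (ρ s) (F (p.2.1 + p.1.1 • p.1.2)) := by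
    have := (abs_le.1 (abs_real_inner_le_norm (ρ s) (F (p.2.1 + p.1.1 • p.1.2)))).1
    have h2 : ‖ρ s‖ * ‖F (p.2.1 + p.1.1 • p.1.2)‖ ≤ M * ‖F (p.2.1 + p.1.1 • p.1.2)‖ := by gcongr
    linarith
  have e : 2 / p.1.1 ^ 2 * inner ℝ (ξ s - Λ p) (F (p.2.1 + p.1.1 • p.1.2)) =
      2 * A * inner ℝ (W p) (p.1.1⁻¹ • (F (p.2.1 + p.1.1 • p.1.2) - F p.2.1)) +
        A ^ 2 * ‖W p‖ ^ 2 * inner ℝ (ρ s) (F (p.2.1 + p.1.1 • p.1.2)) := by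
    rw [hξsub, inner_add_left, real_inner_smul_left, real_inner_smul_left, real_inner_smul_right,
      inner_sub_right, horth]
    field_simp
    ring
  rw [e]
  have := mul_le_mul_of_nonneg_left hρF (by positivity : 0 ≤ A ^ 2 * ‖W p‖ ^ 2)
  simp only [Function.comp_apply]
  linarith

/-- It suffices to exhibit one path in the filter along which the quotient tends to the right-hand
side. The fixed multiplier `lam₀` serves at all its points because `F` maps both curves into `K`. -/
theorem strictSecondSubderiv_le (hQ : Convex ℝ Q) (hl : lam₀ ∈ Q)
    (hU : IsOpen U) (hF : ContDiffOn ℝ 2 F U)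
    (hφ : ∀ x ∈ U, φ x = (r : EReal) + supportFun Q (F x)) (hx₀ : x₀ ∈ U) (h0 : F x₀ = 0)
    (hA : {y : G | ∃ u : E, ∃ z ∈ normalCone Q lam₀, y = fderiv ℝ F x₀ u - z} = univ) {h : E}
    (hh : fderiv ℝ F x₀ h ∈ Submodule.span ℝ (normalCone Q lam₀)) :
    strictSecondSubderiv φ x₀ ((fderiv ℝ F x₀).adjoint lam₀) h ≤
      ((inner ℝ lam₀ (fderiv ℝ (fderiv ℝ F) x₀ h h) : ℝ) : EReal) := by
  set K := normalCone Q lam₀ with hK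
  set L := fderiv ℝ F x₀ with hL
  have hC := hF.contDiffAt (hU.mem_nhds hx₀)
  have hd : HasStrictFDerivAt F L x₀ := hC.hasStrictFDerivAt (by norm_num)
  have hDc : ContinuousAt (fderiv ℝ F) x₀ := (hC.fderiv_right (m := 1) (by norm_num)).continuousAt
  obtain ⟨w, ε, hε, hwK, hwhK, hw, hwh⟩ := exists_mem_nhdsWithin_span_pair
    (convex_normalCone Q lam₀) (zero_mem_normalCone Q lam₀)
    (fun a ha b hb => normalCone_add ha hb) L hA hh
  have hAV : ∀ y : G, ∃ u : E, ∃ z ∈ Submodule.span ℝ K, y = L u - z := fun y => by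
    obtain ⟨u, z, hz, e⟩ : y ∈ {y : G | ∃ u : E, ∃ z ∈ K, y = L u - z} := hA ▸ mem_univ _
    exact ⟨u, z, Submodule.subset_span hz, e⟩
  have hcone : ∀ t : ℝ, 0 ≤ t → ∀ z ∈ K, t • z ∈ K := fun t ht z hz => normalCone_smul ht hz
  obtain ⟨γ₁, h10, h1d, h1K⟩ := exists_curve_in_cone hd h0 hcone _ hAV
    (Submodule.subset_span hwK) hw
  obtain ⟨γ₂, h20, h2d, h2K⟩ := exists_curve_in_cone hd h0 hcone _ hAV
    (Submodule.subset_span hwhK) hwh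
  have hγ₁ : Tendsto γ₁ (𝓝[>] 0) (𝓝 x₀) :=
    h10 ▸ h1d.continuousAt.tendsto.mono_left nhdsWithin_le_nhds
  have hγ₂ : Tendsto γ₂ (𝓝[>] 0) (𝓝 x₀) :=
    h20 ▸ h2d.continuousAt.tendsto.mono_left nhdsWithin_le_nhds
  -- Direction leading from `γ₁ t` to `γ₂ t` in a step of length `ε * t`. The velocities are `w` and
  -- `w + ε • h`, so it tends to `h`.
  let H : ℝ → E := fun t => (ε * t)⁻¹ • (γ₂ t - γ₁ t)
  have hH : Tendsto H (𝓝[>] 0) (𝓝 h) := by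
    have h1 := ((h2d.sub h1d).tendsto_slope_zero_right).const_smul ε⁻¹
    simp only [Pi.sub_apply, zero_add, h10, h20, sub_self, sub_zero, add_sub_cancel_left,
      smul_smul, inv_mul_cancel₀ hε.ne', one_smul] at h1
    refine h1.congr fun t => ?_
    simp only [H, mul_inv]
  have hstep : ∀ t : ℝ, 0 < t → γ₁ t + (ε * t) • H t = γ₂ t := fun t ht => by
    simp only [H]
    rw [smul_smul, mul_inv_cancel₀ (by positivity), one_smul, add_sub_cancel]
  have htime : Tendsto (fun t : ℝ => ε * t) (𝓝[>] 0) (𝓝[>] 0) := by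
    refine tendsto_nhdsWithin_iff.2 ⟨?_, ?_⟩
    · have : Continuous fun t : ℝ => ε * t := by fun_prop
      simpa using (this.tendsto 0).mono_left nhdsWithin_le_nhds
    · filter_upwards [self_mem_nhdsWithin] with t ht using mul_pos hε ht
  have hval : ∀ᶠ t in 𝓝[>] (0 : ℝ), φ (γ₁ t) = ((r + inner ℝ lam₀ (F (γ₁ t)) : ℝ) : EReal) := by
    filter_upwards [h1K, hγ₁.eventually (hU.eventually_mem hx₀)] with t ht htU
    rw [hφ _ htU, supportFun_eq_of_mem_normalCone hQ hl ht, EReal.coe_add]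
  have hval' : ∀ᶠ t in 𝓝[>] (0 : ℝ), φ (γ₂ t) = ((r + inner ℝ lam₀ (F (γ₂ t)) : ℝ) : EReal) := by
    filter_upwards [h2K, hγ₂.eventually (hU.eventually_mem hx₀)] with t ht htU
    rw [hφ _ htU, supportFun_eq_of_mem_normalCone hQ hl ht, EReal.coe_add]
  have hφ₀ : φ x₀ = (r : EReal) := by
    rw [hφ _ hx₀, supportFun_eq_of_mem_normalCone hQ hl (h0 ▸ zero_mem_normalCone Q lam₀), h0,
      inner_zero_right, EReal.coe_zero, add_zero]
  let c : ℝ → (ℝ × E) × (E × E) := fun t =>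
    ((ε * t, H t), (γ₁ t, (fderiv ℝ F (γ₁ t)).adjoint lam₀))
  have hc : Tendsto c (𝓝[>] 0) (strictFilter φ x₀ (L.adjoint lam₀) h) := by
    refine (htime.prodMk hH).prodMk (tendsto_inf.2 ⟨tendsto_nhdsWithin_iff.2 ⟨?_, ?_⟩, ?_⟩)
    · refine hγ₁.prodMk_nhds ?_
      exact tendsto_clm_apply ((ContinuousLinearMap.adjoint.continuous.tendsto _).comp
        (hDc.tendsto.comp hγ₁)) tendsto_const_nhds
    · filter_upwards [h1K, hγ₁.eventually (hU.eventually_mem hx₀)] with t ht htU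
      exact regularSubdiff_subset_subdiff _ _ (adjoint_mem_regularSubdiff hQ hU
        (hF.differentiableOn (by norm_num)) hφ htU hl ht)
    -- Convergence of the values `φ (γ₁ t)`, which holds because `φ` equals the continuous function
    -- `r + ⟨lam₀, F ·⟩` on the curve.
    · rw [tendsto_comap_iff, hφ₀]
      have h1 : Tendsto (fun t => r + inner ℝ lam₀ (F (γ₁ t))) (𝓝[>] 0) (𝓝 r) := by
        have h2 : Tendsto (fun t => F (γ₁ t)) (𝓝[>] 0) (𝓝 0) :=
          h0 ▸ hC.continuousAt.tendsto.comp hγ₁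
        simpa using ((tendsto_const_nhds (x := lam₀)).inner (𝕜 := ℝ) h2).const_add r
      exact ((continuous_coe_real_ereal.tendsto r).comp h1).congr'
        (hval.mono fun t ht => ht.symm)
  have hlim : Tendsto (fun t => secondQuotient φ (c t).1.1 (c t).2.1 (c t).2.2 (c t).1.2) (𝓝[>] 0)
      (𝓝 ((inner ℝ lam₀ (fderiv ℝ (fderiv ℝ F) x₀ h h) : ℝ) : EReal)) := by
    have hT := (tendsto_taylor hC h).comp
      ((tendsto_strictFilter_base φ x₀ (L.adjoint lam₀) h).comp hc)
    refine ((continuous_coe_real_ereal.tendsto _).comp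
      ((tendsto_const_nhds (x := lam₀)).inner (𝕜 := ℝ) hT)).congr' ?_
    filter_upwards [hval, hval', self_mem_nhdsWithin] with t ht ht' ht0
    rw [← hstep t ht0] at ht'
    simp only [Function.comp_apply, c]
    rw [secondQuotient_eq ht' ht, EReal.coe_eq_coe_iff, real_inner_smul_right,
      ContinuousLinearMap.adjoint_inner_left, inner_sub_right, inner_sub_right, inner_smul_right]
    ring
  have hle : strictSecondSubderiv φ x₀ (L.adjoint lam₀) h ≤
      liminf (fun t => secondQuotient φ (c t).1.1 (c t).2.1 (c t).2.2 (c t).1.2) (𝓝[>] 0) :=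
    hc.liminf_le_liminf_comp
  exact hle.trans hlim.liminf_eq.le

end Bounds

end StrictSub

theorem mainTheorem1 (n m : ℕ)
    (φ : EuclideanSpace ℝ (Fin n) → EReal) (hφ : ∀ x, φ x ≠ ⊥)
    (x₀ : EuclideanSpace ℝ (Fin n)) (lam₀ : EuclideanSpace ℝ (Fin m))
    (Q : Set (EuclideanSpace ℝ (Fin m)))
    (F : EuclideanSpace ℝ (Fin n) → EuclideanSpace ℝ (Fin m))
    (hdec : StrictSub.IsStrictlyUDecomposable 2 φ x₀ lam₀ Q F) :
    ∀ h : EuclideanSpace ℝ (Fin n),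
      StrictSub.strictSecondSubderiv φ x₀
          (ContinuousLinearMap.adjoint (fderiv ℝ F x₀) lam₀) h =
        ((inner ℝ lam₀ (fderiv ℝ (fderiv ℝ F) x₀ h h) : ℝ) : EReal) +
          StrictSub.indicatorFun
            (affineSpan ℝ ((fderiv ℝ F x₀) ⁻¹' StrictSub.normalCone Q lam₀) :
              Set (EuclideanSpace ℝ (Fin n))) h := by
  intro h
  obtain ⟨U, hU, hx₀, hF, hdecomp⟩ := hdec.decomp
  obtain ⟨r, hr⟩ : ∃ r : ℝ, φ x₀ = r :=
    ⟨_, (EReal.coe_toReal (ne_of_lt hdec.mem_dom) (hφ x₀)).symm⟩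
  rw [hr] at hdecomp
  have hF : ContDiffOn ℝ 2 F U := hF
  have hmem := StrictSub.mem_affineSpan_preimage_iff (fderiv ℝ F x₀)
    (StrictSub.convex_normalCone Q lam₀) (StrictSub.zero_mem_normalCone Q lam₀)
    (fun a ha b hb => StrictSub.normalCone_add ha hb) hdec.strict h
  by_cases hh : fderiv ℝ F x₀ h ∈ Submodule.span ℝ (StrictSub.normalCone Q lam₀)
  · rw [StrictSub.indicatorFun, if_pos (SetLike.mem_coe.2 (hmem.2 hh)), add_zero]
    exact le_antisymm
      (StrictSub.strictSecondSubderiv_le hdec.convex hdec.mem_support hU hF hdecomp hx₀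
        hdec.map_base hdec.strict hh)
      (StrictSub.le_strictSecondSubderiv hdec.closed hdec.convex hdec.mem_support hU hF hdecomp hx₀
        hdec.strict h)
  · rw [StrictSub.indicatorFun, if_neg fun hn => hh (hmem.1 (SetLike.mem_coe.1 hn)), EReal.coe_add_top]
    exact StrictSub.strictSecondSubderiv_eq_top hdec.closed hdec.convex hdec.mem_support hU hF
      hdecomp hx₀ hdec.map_base hdec.strict hdec.usotp hh
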